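/- There is a polynomial-time algorithm that, given rational numbers $a_1,\dots,a_n$ and a rational number $\varepsilon$ with $0<\varepsilon<1$, finds integers $p_1,\dots,p_n,q$ such that $$|p_i-q a_i|\le\varepsilon\quad(1\le i\le n)\qquad\text{and}\qquad 1\le q\le 2^{n(n+1)/4}\,\varepsilon^{-n}.$$ Here $n$ is part of the input. Rational numbers are given by their numerators and denominators (in lowest terms) in binary. Running time is the logarithmic cost on a random access machine with integer addition, subtraction, multiplication and division (each operation is charged the total bit length of its operands and addresses), and it is bounded by a fixed polynomial in the total bit length of $a_1,\dots,a_n,\varepsilon$. -/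

import Mathlib

/-! A random access machine for integers, with the logarithmic cost criterion.

A program has integer arrays, named by natural numbers; an instruction names the array it uses
explicitly, so that a program uses only finitely many of them. The cells of an array are addressed
by integers that may be computed at run time (indirect addressing). Programs are given in
structured form (sequence, branching, loop). Every operation is charged the total bit length of its
operands, the addresses included, so that the cost of a run is, up to a polynomial, the number of
bit operations. -/

namespace RAM

/-- The number of binary digits of `|x|`. -/
def bitLength (x : ℤ) : ℕ := Nat.size x.natAbs

/-- The contents of the memory: `M k j` is cell `j` of array `k`. -/
abbrev Memory := ℕ → ℤ → ℤ

/-- The memory `M` after `x` has been written to cell `j` of array `k`. -/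
def Memory.write (M : Memory) (k : ℕ) (j x : ℤ) : Memory :=
  fun k' j' => if k' = k ∧ j' = j then x else M k' j'

/-- The arithmetic operations of the machine. -/
inductive Op where
  | add
  | sub
  | mul
  | div

/-- The effect of an operation. `div` is Euclidean division of integers (the remainder is
non-negative), with the convention `x / 0 = 0`. -/
def Op.apply : Op → ℤ → ℤ → ℤ
  | .add, x, y => x + y
  | .sub, x, y => x - y
  | .mul, x, y => x * y
  | .div, x, y => x / y

/-- Expressions: integer constants, the content of the cell of array `k` whose address is the value
of `e`, and arithmetic operations. -/
inductive Expr where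
  | const (c : ℤ)
  | read (k : ℕ) (e : Expr)
  | op (o : Op) (e₁ e₂ : Expr)

/-- The value of an expression. -/
def Expr.eval (M : Memory) : Expr → ℤ
  | .const c => c
  | .read k e => M k (e.eval M)
  | .op o e₁ e₂ => o.apply (e₁.eval M) (e₂.eval M)

/-- The logarithmic cost of the evaluation of an expression. -/
def Expr.cost (M : Memory) : Expr → ℕ
  | .const c => 1 + bitLength c
  | .read k e => e.cost M + 1 + bitLength (e.eval M) + bitLength (M k (e.eval M))
  | .op _ e₁ e₂ => e₁.cost M + e₂.cost M + 1 + bitLength (e₁.eval M) + bitLength (e₂.eval M)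

/-- Programs. `write k e₁ e₂` writes the value of `e₂` to the cell of array `k` whose address is the
value of `e₁`; `branch e P Q` runs `P` if the value of `e` is positive, and `Q` otherwise;
`loop e P` runs `P` as long as the value of `e` is positive. -/
inductive Program where
  | skip
  | write (k : ℕ) (e₁ e₂ : Expr)
  | seq (P Q : Program)
  | branch (e : Expr) (P Q : Program)
  | loop (e : Expr) (P : Program)

/-- `Runs P M t M'`: started with memory `M`, the program `P` halts with memory `M'`, and the run has
logarithmic cost `t`. -/
inductive Runs : Program → Memory → ℕ → Memory → Prop where
  | skip (M : Memory) : Runs .skip M 1 M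
  | write (M : Memory) (k : ℕ) (e₁ e₂ : Expr) :
      Runs (.write k e₁ e₂) M
        (e₁.cost M + e₂.cost M + 1 + bitLength (e₁.eval M) + bitLength (e₂.eval M))
        (M.write k (e₁.eval M) (e₂.eval M))
  | seq {P Q : Program} {M M' M'' : Memory} {t t' : ℕ} :
      Runs P M t M' → Runs Q M' t' M'' → Runs (.seq P Q) M (t + t') M''
  | branch_pos {e : Expr} {P Q : Program} {M M' : Memory} {t : ℕ} :
      0 < e.eval M → Runs P M t M' →
      Runs (.branch e P Q) M (e.cost M + 1 + bitLength (e.eval M) + t) M'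
  | branch_nonpos {e : Expr} {P Q : Program} {M M' : Memory} {t : ℕ} :
      e.eval M ≤ 0 → Runs Q M t M' →
      Runs (.branch e P Q) M (e.cost M + 1 + bitLength (e.eval M) + t) M'
  | loop_pos {e : Expr} {P : Program} {M M' M'' : Memory} {t t' : ℕ} :
      0 < e.eval M → Runs P M t M' → Runs (.loop e P) M' t' M'' →
      Runs (.loop e P) M (e.cost M + 1 + bitLength (e.eval M) + t + t') M''
  | loop_nonpos {e : Expr} {P : Program} {M : Memory} :
      e.eval M ≤ 0 → Runs (.loop e P) M (e.cost M + 1 + bitLength (e.eval M)) M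

/-- The machine is deterministic: a program has at most one halting run from a given memory. -/
theorem Runs.deterministic {P : Program} {M M₁ : Memory} {t₁ : ℕ} (h₁ : Runs P M t₁ M₁) :
    ∀ {t₂ : ℕ} {M₂ : Memory}, Runs P M t₂ M₂ → t₁ = t₂ ∧ M₁ = M₂ := by
  induction h₁ with
  | skip M => intro _ _ h; cases h; exact ⟨rfl, rfl⟩
  | write M k e₁ e₂ => intro _ _ h; cases h; exact ⟨rfl, rfl⟩
  | seq _ _ ih ih' =>
    intro _ _ h
    cases h with
    | seq h h' =>
      obtain ⟨rfl, rfl⟩ := ih h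
      obtain ⟨rfl, rfl⟩ := ih' h'
      exact ⟨rfl, rfl⟩
  | branch_pos hp _ ih =>
    intro _ _ h
    cases h with
    | branch_pos _ h => obtain ⟨rfl, rfl⟩ := ih h; exact ⟨rfl, rfl⟩
    | branch_nonpos hn _ => exact absurd hp (not_lt.mpr hn)
  | branch_nonpos hn _ ih =>
    intro _ _ h
    cases h with
    | branch_pos hp _ => exact absurd hp (not_lt.mpr hn)
    | branch_nonpos _ h => obtain ⟨rfl, rfl⟩ := ih h; exact ⟨rfl, rfl⟩
  | loop_pos hp _ _ ih ih' =>
    intro _ _ h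
    cases h with
    | loop_pos _ h h' =>
      obtain ⟨rfl, rfl⟩ := ih h
      obtain ⟨rfl, rfl⟩ := ih' h'
      exact ⟨rfl, rfl⟩
    | loop_nonpos hn => exact absurd hp (not_lt.mpr hn)
  | loop_nonpos hn =>
    intro _ _ h
    cases h with
    | loop_pos hp _ _ => exact absurd hp (not_lt.mpr hn)
    | loop_nonpos _ => exact ⟨rfl, rfl⟩

end RAM

namespace SimultaneousApproximation

/-- The binary encoding length of a rational number, given by its numerator and its denominator in
lowest terms. -/
def ratSize (r : ℚ) : ℕ := 1 + RAM.bitLength r.num + RAM.bitLength r.den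

/-- The binary encoding length of the instance `(a₁, …, aₙ, ε)`. -/
def inputSize {n : ℕ} (a : Fin n → ℚ) (ε : ℚ) : ℕ := ratSize ε + ∑ i, ratSize (a i)

/-- The memory that holds the instance `(a₁, …, aₙ, ε)`: array `0` holds `n` in cell `0`; arrays `1`
and `2` hold the numerators and the denominators (in lowest terms) of `ε, a₁, …, aₙ` in the cells
`0, 1, …, n`; all other cells hold `0`. -/
def inputMemory {n : ℕ} (a : Fin n → ℚ) (ε : ℚ) : RAM.Memory
  | 0, j => if j = 0 then (n : ℤ) else 0
  | 1, j => if h : 0 ≤ j ∧ j ≤ (n : ℤ) then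
      ((Fin.cons ε a : Fin (n + 1) → ℚ) ⟨j.toNat, by omega⟩).num else 0
  | 2, j => if h : 0 ≤ j ∧ j ≤ (n : ℤ) then
      (((Fin.cons ε a : Fin (n + 1) → ℚ) ⟨j.toNat, by omega⟩).den : ℤ) else 0
  | _, _ => 0

/-- The memory `M` holds the answer `(p₁, …, pₙ, q)`: in array `3`, cell `0` holds `q` and the cells
`1, …, n` hold `p₁, …, pₙ`. -/
def HoldsOutput {n : ℕ} (M : RAM.Memory) (p : Fin n → ℤ) (q : ℤ) : Prop :=
  M 3 0 = q ∧ ∀ i : Fin n, M 3 ((i : ℤ) + 1) = p i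

end SimultaneousApproximation

namespace RAM

theorem bitLength_le_iff {x : ℤ} {b : ℕ} : bitLength x ≤ b ↔ |x| < 2 ^ b := by
  rw [bitLength, Nat.size_le, Int.abs_eq_natAbs]
  exact_mod_cast Iff.rfl

theorem abs_lt_two_pow_bitLength (x : ℤ) : |x| < 2 ^ bitLength x :=
  bitLength_le_iff.1 le_rfl

theorem bitLength_apply_le (o : Op) (x y : ℤ) :
    bitLength (o.apply x y) ≤ 1 + bitLength x + bitLength y := by
  have hx := abs_lt_two_pow_bitLength x
  have hy := abs_lt_two_pow_bitLength y
  have h1 : (1 : ℤ) ≤ 2 ^ bitLength x := one_le_pow₀ (by norm_num)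
  have h2 : (1 : ℤ) ≤ 2 ^ bitLength y := one_le_pow₀ (by norm_num)
  have hs : |x| + |y| < 2 ^ (1 + bitLength x + bitLength y) := by
    rw [pow_add, pow_add]; nlinarith
  have hp : (2 : ℤ) ^ bitLength x * 2 ^ bitLength y ≤ 2 ^ (1 + bitLength x + bitLength y) := by
    rw [pow_add, pow_add]; nlinarith
  rw [bitLength_le_iff]
  cases o with
  | add => exact (abs_add_le x y).trans_lt hs
  | sub => exact (abs_sub x y).trans_lt hs
  | mul =>
    refine lt_of_lt_of_le ?_ hp
    rw [Op.apply, abs_mul]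
    exact mul_lt_mul'' hx hy (abs_nonneg _) (abs_nonneg _)
  | div =>
    have : |x / y| ≤ |x| := Int.abs_ediv_le_abs x y
    have hy0 := abs_nonneg y
    exact (this.trans (le_add_of_nonneg_right hy0)).trans_lt hs

/-- All cells of the memory have at most `b` binary digits. -/
def Memory.Bounded (b : ℕ) (M : Memory) : Prop := ∀ k j, |M k j| < 2 ^ b

theorem Memory.Bounded.write {b : ℕ} {M : Memory} (h : M.Bounded b) (k : ℕ) (j : ℤ) {x : ℤ}
    (hx : |x| < 2 ^ b) : (M.write k j x).Bounded b := by
  intro k' j'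
  unfold Memory.write
  split_ifs
  exacts [hx, h k' j']

theorem Memory.write_same (M : Memory) (k : ℕ) (j x : ℤ) : M.write k j x k j = x := by
  simp [Memory.write]

theorem Memory.write_array_ne (M : Memory) {k k' : ℕ} (j x : ℤ) (h : k' ≠ k) :
    M.write k j x k' = M k' := by
  funext j'; simp [Memory.write, h]

theorem Memory.write_cell_ne (M : Memory) {k : ℕ} {j j' : ℤ} (x : ℤ) (h : j' ≠ j) :
    M.write k j x k j' = M k j' := by
  simp [Memory.write, h]

/-- A constant such that the evaluation of the expression in a memory with entries of `b` digits
costs at most this constant times `b + 1`. -/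
def Expr.weight : Expr → ℕ
  | .const c => 1 + bitLength c
  | .read _ e => 2 * e.weight + 2
  | .op _ e₁ e₂ => 2 * e₁.weight + 2 * e₂.weight + 1

theorem Expr.bitLength_eval_le_cost (M : Memory) (e : Expr) :
    bitLength (e.eval M) ≤ e.cost M := by
  cases e with
  | const c => simp [Expr.eval, Expr.cost]
  | read k e => simp only [Expr.eval, Expr.cost]; omega
  | op o e₁ e₂ =>
    have := bitLength_apply_le o (e₁.eval M) (e₂.eval M)
    simp only [Expr.eval, Expr.cost]; omega

theorem Expr.cost_le {b : ℕ} {M : Memory} (h : M.Bounded b) (e : Expr) :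
    e.cost M ≤ e.weight * (b + 1) := by
  induction e with
  | const c => exact Nat.le_mul_of_pos_right _ (Nat.succ_pos b)
  | read k e ih =>
    have h1 := e.bitLength_eval_le_cost M
    have h2 : bitLength (M k (e.eval M)) ≤ b := bitLength_le_iff.2 (h _ _)
    simp only [Expr.cost, Expr.weight]
    nlinarith
  | op o e₁ e₂ ih₁ ih₂ =>
    have h1 := e₁.bitLength_eval_le_cost M
    have h2 := e₂.bitLength_eval_le_cost M
    simp only [Expr.cost, Expr.weight]
    nlinarith

/-- The total weight of the expressions and statements of a program. -/
def Program.weight : Program → ℕ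
  | .skip => 1
  | .write _ e₁ e₂ => 2 * e₁.weight + 2 * e₂.weight + 1
  | .seq P Q => P.weight + Q.weight
  | .branch e P Q => 2 * e.weight + 1 + P.weight + Q.weight
  | .loop e P => 2 * e.weight + 1 + P.weight

/-- The program halts from `M`, at a cost of at most `C` times its weight, in a memory with the
property `Q`. -/
def WP (C : ℕ) (P : Program) (Q : Memory → Prop) (M : Memory) : Prop :=
  ∃ t M', Runs P M t M' ∧ t ≤ P.weight * C ∧ Q M'

namespace WP

variable {b C C' : ℕ} {P P' : Program} {Q R : Memory → Prop} {M : Memory} {e e₁ e₂ : Expr}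

theorem conseq (h : WP C P Q M) (hQ : ∀ M', Q M' → R M') : WP C P R M := by
  obtain ⟨t, M', h1, h2, h3⟩ := h
  exact ⟨t, M', h1, h2, hQ _ h3⟩

theorem mono (hC : C ≤ C') (h : WP C P Q M) : WP C' P Q M := by
  obtain ⟨t, M', h1, h2, h3⟩ := h
  exact ⟨t, M', h1, h2.trans (Nat.mul_le_mul_left _ hC), h3⟩

theorem skip (hC : b + 1 ≤ C) (h : Q M) : WP C .skip Q M :=
  ⟨1, M, .skip M, by simp only [Program.weight]; omega, h⟩

theorem write {k : ℕ} (hM : M.Bounded b) (hC : b + 1 ≤ C)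
    (h : Q (M.write k (e₁.eval M) (e₂.eval M))) : WP C (.write k e₁ e₂) Q M := by
  refine ⟨_, _, .write M k e₁ e₂, ?_, h⟩
  have h1 := e₁.bitLength_eval_le_cost M
  have h2 := e₂.bitLength_eval_le_cost M
  have h3 := e₁.cost_le hM
  have h4 := e₂.cost_le hM
  have h5 := Nat.mul_le_mul_left e₁.weight hC
  have h6 := Nat.mul_le_mul_left e₂.weight hC
  simp only [Program.weight]
  nlinarith

theorem seq (h : WP C P (fun M' => WP C P' Q M') M) : WP C (.seq P P') Q M := by
  obtain ⟨t, M', h1, h2, t', M'', h3, h4, h5⟩ := h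
  refine ⟨_, _, .seq h1 h3, ?_, h5⟩
  simp only [Program.weight]
  nlinarith

theorem branch (hM : M.Bounded b) (hC : b + 1 ≤ C) (h : 0 < e.eval M → WP C P Q M)
    (h' : e.eval M ≤ 0 → WP C P' Q M) : WP C (.branch e P P') Q M := by
  have h1 := e.bitLength_eval_le_cost M
  have h2 := e.cost_le hM
  have h3 := Nat.mul_le_mul_left e.weight hC
  rcases lt_or_ge 0 (e.eval M) with he | he
  · obtain ⟨t, M', h4, h5, h6⟩ := h he
    refine ⟨_, _, .branch_pos he h4, ?_, h6⟩
    simp only [Program.weight]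
    nlinarith [Nat.zero_le (P'.weight * C)]
  · obtain ⟨t, M', h4, h5, h6⟩ := h' he
    refine ⟨_, _, .branch_nonpos he h4, ?_, h6⟩
    simp only [Program.weight]
    nlinarith [Nat.zero_le (P.weight * C)]

/-- A loop with a variant: `I s` holds at the test when at most `s` iterations are left. -/
theorem loop (I : ℕ → Memory → Prop) (hC : b + 1 ≤ C) (hI : ∀ s M, I s M → M.Bounded b)
    (hstep : ∀ s M, I s M → 0 < e.eval M → ∃ s', s = s' + 1 ∧ WP C P (I s') M) {s : ℕ}
    (h : I s M) (hC' : (s + 1) * C ≤ C') (hQ : ∀ s M, I s M → e.eval M ≤ 0 → Q M) :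
    WP C' (.loop e P) Q M := by
  refine mono hC' ?_
  clear hC'
  induction s generalizing M with
  | zero =>
    have h1 := e.bitLength_eval_le_cost M
    have h2 := e.cost_le (hI _ _ h)
    have h3 := Nat.mul_le_mul_left e.weight hC
    rcases lt_or_ge 0 (e.eval M) with he | he
    · obtain ⟨s', hs', -⟩ := hstep _ _ h he
      omega
    · refine ⟨_, _, .loop_nonpos he, ?_, hQ _ _ h he⟩
      simp only [Program.weight]
      nlinarith [Nat.zero_le (P.weight * C)]
  | succ s ih =>
    have h1 := e.bitLength_eval_le_cost M
    have h2 := e.cost_le (hI _ _ h)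
    have h3 := Nat.mul_le_mul_left e.weight hC
    rcases lt_or_ge 0 (e.eval M) with he | he
    · obtain ⟨s', hs', t, M', h4, h5, h6⟩ := hstep _ _ h he
      obtain rfl : s = s' := by omega
      obtain ⟨t', M'', h7, h8, h9⟩ := ih h6
      refine ⟨_, _, .loop_pos he h4 h7, ?_, h9⟩
      simp only [Program.weight] at h8 ⊢
      nlinarith
    · refine ⟨_, _, .loop_nonpos he, ?_, hQ _ _ h he⟩
      simp only [Program.weight]
      nlinarith [Nat.zero_le (P.weight * C), Nat.zero_le (s * (e.weight * C)),
        Nat.zero_le (s * C), Nat.zero_le (s * (P.weight * C))]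

end WP

/-- The scalar variable kept in cell `0` of array `k`. -/
def var (k : ℕ) : Expr := .read k (.const 0)

/-- Assignment to a scalar variable. -/
def assign (k : ℕ) (e : Expr) : Program := .write k (.const 0) e

/-- The loop over `i = 0, …, e - 1`. -/
def forTo (i : ℕ) (e : Expr) (P : Program) : Program :=
  .seq (assign i (.const 0)) (.loop (.op .sub e (var i))
    (.seq P (assign i (.op .add (var i) (.const 1)))))

@[simp] theorem eval_const (M : Memory) (c : ℤ) : (Expr.const c).eval M = c := rfl
@[simp] theorem eval_var (M : Memory) (k : ℕ) : (var k).eval M = M k 0 := rfl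
@[simp] theorem eval_read (M : Memory) (k : ℕ) (e : Expr) :
    (Expr.read k e).eval M = M k (e.eval M) := rfl
@[simp] theorem eval_add (M : Memory) (e₁ e₂ : Expr) :
    (Expr.op .add e₁ e₂).eval M = e₁.eval M + e₂.eval M := rfl
@[simp] theorem eval_sub (M : Memory) (e₁ e₂ : Expr) :
    (Expr.op .sub e₁ e₂).eval M = e₁.eval M - e₂.eval M := rfl
@[simp] theorem eval_mul (M : Memory) (e₁ e₂ : Expr) :
    (Expr.op .mul e₁ e₂).eval M = e₁.eval M * e₂.eval M := rfl
@[simp] theorem eval_div (M : Memory) (e₁ e₂ : Expr) :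
    (Expr.op .div e₁ e₂).eval M = e₁.eval M / e₂.eval M := rfl

namespace WP

variable {b C C' : ℕ} {P : Program} {Q : Memory → Prop} {M : Memory} {e : Expr}

theorem assign {k : ℕ} (hM : M.Bounded b) (hC : b + 1 ≤ C) (h : Q (M.write k 0 (e.eval M))) :
    WP C (assign k e) Q M :=
  WP.write hM hC h

theorem forTo {i : ℕ} {N : ℕ} (I : ℕ → Memory → Prop) (hC : b + 1 ≤ C) (hN : (N : ℤ) < 2 ^ b)
    (hM : M.Bounded b) (h0 : I 0 (M.write i 0 0)) (he : ∀ x M, I x M → e.eval M = N)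
    (hstep : ∀ x < N, ∀ M, M.Bounded b → M i 0 = (x : ℤ) → I x M →
      WP C P (fun M' => M'.Bounded b ∧ M' i 0 = (x : ℤ) ∧ I (x + 1) (M'.write i 0 (x + 1 : ℕ))) M)
    (hC' : (N + 1) * C ≤ C') (hQ : ∀ M, M.Bounded b → I N M → Q M) :
    WP C' (forTo i e P) Q M := by
  have hCC : C ≤ C' := by nlinarith
  refine seq (assign hM (hC.trans hCC) ?_)
  refine loop (fun s M => ∃ x, x + s = N ∧ M.Bounded b ∧ M i 0 = (x : ℤ) ∧ I x M) hC
    (fun s M ⟨_, _, h, _⟩ => h) ?_ (s := N)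
    ⟨0, by omega, hM.write _ _ (by simp), by simp [Memory.write_same], h0⟩ hC' ?_
  · rintro s M ⟨x, hx, hB, hi, hI⟩ hpos
    have hxN : x < N := by
      rw [eval_sub, he x M hI, eval_var, hi] at hpos
      omega
    refine ⟨s - 1, by omega, seq ?_⟩
    refine (hstep x hxN M hB hi hI).conseq ?_
    rintro M' ⟨h1, h2, h3⟩
    refine assign h1 hC ⟨x + 1, by omega, h1.write _ _ ?_, ?_, ?_⟩
    · simp only [eval_add, eval_var, h2, eval_const]
      rw [abs_of_nonneg (by positivity)]
      exact lt_of_le_of_lt (by exact_mod_cast hxN) hN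
    · simp [Memory.write_same, h2]
    · simpa [h2] using h3
  · rintro s M ⟨x, hx, hB, hi, hI⟩ hle
    rw [eval_sub, he x M hI, eval_var, hi] at hle
    obtain rfl : x = N := by omega
    exact hQ M hB hI

end WP

end RAM

/-! Integral lattice reduction. -/

namespace LatticeReduction

open Finset

/-- The numbers `D 0 = 1, D 1, …` and the lower triangular matrix `L` with diagonal
`L j j = D (j + 1)` are the integral Gram-Schmidt data of the matrix
`∑ j, L k j * L l j / (D (j + 1) * D j)`. -/
structure Triangular (m : ℕ) (D : ℕ → ℚ) (L : ℕ → ℕ → ℚ) : Prop where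
  zero : D 0 = 1
  pos : ∀ j ≤ m, 0 < D j
  diag : ∀ j < m, L j j = D (j + 1)
  upper : ∀ i < m, ∀ j < m, i < j → L i j = 0

/-- The Gram matrix of integral Gram-Schmidt data. -/
def gramSum (m : ℕ) (D : ℕ → ℚ) (x y : ℕ → ℚ) : ℚ :=
  ∑ j ∈ range m, x j * y j / (D (j + 1) * D j)

theorem gramSum_eq_of_lt {m j : ℕ} {D : ℕ → ℚ} {x y : ℕ → ℚ} (hj : j < m)
    (hy : ∀ i < m, j < i → y i = 0) : gramSum m D x y = gramSum (j + 1) D x y := by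
  refine (sum_subset (range_mono hj) fun i hi hi' => ?_).symm
  rw [mem_range] at hi hi'
  rw [hy i hi (by omega)]
  simp

theorem prod_prod_eq {D : ℕ → ℚ} (h0 : D 0 = 1) (j : ℕ) :
    (∏ i ∈ range j, D (i + 1)) * (∏ i ∈ range j, D (i + 1)) * D (j + 1) =
      ∏ i ∈ range (j + 1), (D (i + 1) * D i) := by
  rw [prod_mul_distrib, prod_range_succ, prod_range_succ' (fun i => (D i : ℚ)), h0]
  ring

theorem Triangular.exists_int {m : ℕ} {D : ℕ → ℚ} {L : ℕ → ℕ → ℚ} (h : Triangular m D L)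
    (hG : ∀ k < m, ∀ l < m, ∃ z : ℤ, gramSum m D (L k) (L l) = z) {k j : ℕ} (hk : k < m)
    (hj : j < m) : ∃ z : ℤ, L k j = z := by
  classical
  rcases lt_or_ge k j with hkj | hkj
  · exact ⟨0, by simpa using h.upper k hk j hj hkj⟩
  choose! z hz using hG
  let ρ : Fin (j + 1) → ℕ := fun i => if (i : ℕ) = j then k else i
  have hρ : ∀ i, ρ i < m := fun i => by
    have := i.2
    simp only [ρ]; split_ifs <;> omega
  let S : Matrix (Fin (j + 1)) (Fin (j + 1)) ℚ := Matrix.of fun i c => L (ρ i) c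
  let E : Matrix (Fin (j + 1)) (Fin (j + 1)) ℚ :=
    Matrix.diagonal fun c => (D (c + 1) * D c)⁻¹
  let T : Matrix (Fin (j + 1)) (Fin (j + 1)) ℚ := Matrix.of fun i c => L i c
  let Z : Matrix (Fin (j + 1)) (Fin (j + 1)) ℤ :=
    Matrix.of fun i c => z (ρ i) c
  have hprod : S * E * T.transpose = (Int.castRingHom ℚ).mapMatrix Z := by
    ext i c
    rw [Matrix.mul_apply]
    have h1 : gramSum m D (L (ρ i)) (L c) = gramSum (j + 1) D (L (ρ i)) (L c) :=
      gramSum_eq_of_lt hj fun i' hi' hji => h.upper _ (by omega) _ hi' (by omega)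
    have h2 := hz (ρ i) (hρ i) c (by omega)
    rw [h1, gramSum, sum_range] at h2
    simp only [RingHom.mapMatrix_apply, Matrix.map_apply, Z, Matrix.of_apply, eq_intCast]
    rw [← h2]
    refine sum_congr rfl fun a _ => ?_
    simp only [E, Matrix.mul_diagonal, S, T, Matrix.of_apply, Matrix.transpose_apply]
    rw [div_eq_mul_inv]
    ring
  have hS : S.det = (∏ i ∈ range j, D (i + 1)) * L k j := by
    rw [Matrix.det_of_isLowerTriangular S ?_, Fin.prod_univ_castSucc, prod_range]
    · congr 1
      · refine prod_congr rfl fun i _ => ?_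
        have := i.2
        simp only [S, ρ, Matrix.of_apply, Fin.val_castSucc]
        rw [if_neg (by omega), h.diag _ (by omega)]
      · simp [S, ρ]
    · intro a c hac
      have hac' : (a : ℕ) < c := by simpa using hac
      have := c.2
      simp only [S, ρ, Matrix.of_apply]
      rw [if_neg (by omega)]
      exact h.upper _ (by omega) _ (by omega) hac'
  have hT : T.det = ∏ i ∈ range (j + 1), D (i + 1) := by
    rw [Matrix.det_of_isLowerTriangular T ?_, prod_range]
    · exact prod_congr rfl fun i _ => h.diag _ (by omega)
    · intro a c hac
      have hac' : (a : ℕ) < c := by simpa using hac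
      exact h.upper _ (by omega) _ (by omega) hac'
  have hE : E.det = (∏ i ∈ range (j + 1), (D (i + 1) * D i))⁻¹ := by
    rw [Matrix.det_diagonal, ← prod_inv_distrib, prod_range]
  have hdet := congrArg Matrix.det hprod
  rw [Matrix.det_mul, Matrix.det_mul, Matrix.det_transpose, hS, hT, hE,
    ← RingHom.map_det, eq_intCast, ← prod_prod_eq h.zero j,
    prod_range_succ] at hdet
  have hne : (∏ i ∈ range j, D (i + 1)) ≠ 0 :=
    prod_ne_zero_iff.2 fun i hi =>
      (h.pos (i + 1) (by rw [mem_range] at hi; omega)).ne'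
  have hne' : (D (j + 1) : ℚ) ≠ 0 := (h.pos (j + 1) hj).ne'
  refine ⟨Z.det, ?_⟩
  rw [← hdet]
  field_simp

theorem gramSum_sub_left {m : ℕ} {D : ℕ → ℚ} (x x' y : ℕ → ℚ) (r : ℚ) :
    gramSum m D (fun c => x c - r * x' c) y = gramSum m D x y - r * gramSum m D x' y := by
  simp only [gramSum, mul_sum, ← sum_sub_distrib]
  exact sum_congr rfl fun c _ => by ring

theorem gramSum_comm {m : ℕ} {D : ℕ → ℚ} (x y : ℕ → ℚ) : gramSum m D x y = gramSum m D y x :=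
  sum_congr rfl fun c _ => by ring

/-- The matrix `A` holds the integral Gram-Schmidt coefficients (in the columns below `m`) and the
coordinates (in the columns from `m` on) of vectors in a lattice with the bilinear form `G`. -/
structure Inv (m : ℕ) (G : (ℕ → ℤ) →ₗ[ℤ] (ℕ → ℤ) →ₗ[ℤ] ℤ) (D : ℕ → ℤ) (A : ℕ → ℕ → ℤ) : Prop where
  tri : Triangular m (fun j => D j) fun i j => A i j
  gram : ∀ k < m, ∀ l < m, gramSum m (fun j => D j) (fun j => A k j) (fun j => A l j) =
    G (fun c => A k (m + c)) (fun c => A l (m + c))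

section

variable {m : ℕ} {G : (ℕ → ℤ) →ₗ[ℤ] (ℕ → ℤ) →ₗ[ℤ] ℤ} {D : ℕ → ℤ} {A : ℕ → ℕ → ℤ}

theorem Inv.diag (h : Inv m G D A) {j : ℕ} (hj : j < m) : A j j = D (j + 1) := by
  exact_mod_cast h.tri.diag j hj

theorem Inv.upper (h : Inv m G D A) {i j : ℕ} (hi : i < m) (hj : j < m) (hij : i < j) :
    A i j = 0 := by
  exact_mod_cast h.tri.upper i hi j hj hij

/-- The value of the quadratic form at the `k`-th vector. -/
def normSq (m : ℕ) (G : (ℕ → ℤ) →ₗ[ℤ] (ℕ → ℤ) →ₗ[ℤ] ℤ) (A : ℕ → ℕ → ℤ) (k : ℕ) : ℤ :=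
  G (fun c => A k (m + c)) (fun c => A k (m + c))

/-- Subtract `r` times row `j` from row `k`. -/
def rowSub (A : ℕ → ℕ → ℤ) (k j : ℕ) (r : ℤ) (i c : ℕ) : ℤ :=
  if i = k then A k c - r * A j c else A i c

theorem Inv.rowSub (h : Inv m G D A) {k j : ℕ} (hjk : j < k) (hk : k < m) (r : ℤ) :
    Inv m G D (rowSub A k j r) := by
  have hrow : ∀ i c, LatticeReduction.rowSub A k j r i c =
      if i = k then A k c - r * A j c else A i c := fun _ _ => rfl
  refine ⟨⟨h.tri.zero, h.tri.pos, fun i hi => ?_, fun i hi c hc hic => ?_⟩, fun a ha l hl => ?_⟩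
  · simp only [hrow]
    split_ifs with hik
    · subst hik
      rw [h.upper (hjk.trans hk) hk hjk, h.diag hk]
      simp
    · exact h.tri.diag i hi
  · simp only [hrow]
    split_ifs with hik
    · subst hik
      rw [h.upper (hjk.trans hk) hc (hjk.trans hic), h.upper hk hc hic]
      simp
    · exact h.tri.upper i hi c hc hic
  · have hj := hjk.trans hk
    have key : ∀ y : ℕ → ℚ, ∀ y' : ℕ → ℤ,
        (∀ a < m, gramSum m (fun j => D j) (fun c => A a c) y = G (fun c => A a (m + c)) y') →
        ∀ a < m, gramSum m (fun j => D j) (fun c => LatticeReduction.rowSub A k j r a c) y =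
          G (fun c => LatticeReduction.rowSub A k j r a (m + c)) y' := by
      intro y y' hy a ha
      simp only [hrow]
      split_ifs with hak
      · have : (fun c => A k (m + c) - r * A j (m + c)) =
            (fun c => A k (m + c)) - r • (fun c => A j (m + c)) := by
          funext c; simp
        rw [this, map_sub, map_smul, LinearMap.sub_apply, LinearMap.smul_apply]
        push_cast
        rw [gramSum_sub_left (fun c => (A k c : ℚ)) (fun c => (A j c : ℚ)), hy k hk, hy j hj]
        simp
      · exact hy a ha
    have key' : ∀ y : ℕ → ℚ, ∀ y' : ℕ → ℤ,
        (∀ a < m, gramSum m (fun j => D j) y (fun c => A a c) = G y' (fun c => A a (m + c))) →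
        ∀ a < m, gramSum m (fun j => D j) y (fun c => LatticeReduction.rowSub A k j r a c) =
          G y' (fun c => LatticeReduction.rowSub A k j r a (m + c)) := by
      intro y y' hy a ha
      simp only [hrow]
      split_ifs with hak
      · have : (fun c => A k (m + c) - r * A j (m + c)) =
            (fun c => A k (m + c)) - r • (fun c => A j (m + c)) := by
          funext c; simp
        rw [this, map_sub, map_smul, gramSum_comm]
        push_cast
        rw [gramSum_sub_left (fun c => (A k c : ℚ)) (fun c => (A j c : ℚ)), gramSum_comm,
          gramSum_comm _ y, hy k hk, hy j hj]
        simp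
      · exact hy a ha
    exact key _ _ (fun b hb => key' _ _ (fun c hc => h.gram b hb c hc) l hl) a ha

/-- The transposition of `k` and `k + 1`. -/
def adjSwap (k i : ℕ) : ℕ := if i = k then k + 1 else if i = k + 1 then k else i

theorem adjSwap_lt {k i : ℕ} (hk : k + 1 < m) (hi : i < m) : adjSwap k i < m := by
  unfold adjSwap; split_ifs <;> omega

/-- The determinants after the exchange of the vectors `k` and `k + 1`. -/
def swapDet (D : ℕ → ℤ) (A : ℕ → ℕ → ℤ) (k j : ℕ) : ℤ :=
  if j = k + 1 then (D k * D (k + 2) + A (k + 1) k * A (k + 1) k) / D (k + 1) else D j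

/-- The coefficients and coordinates after the exchange of the vectors `k` and `k + 1`. -/
def swapStep (D : ℕ → ℤ) (A : ℕ → ℕ → ℤ) (k i c : ℕ) : ℤ :=
  if c = k then
    (D k * A (adjSwap k i) (k + 1) + A (k + 1) k * A (adjSwap k i) k) / D (k + 1)
  else if c = k + 1 then
    (D (k + 2) * A (adjSwap k i) k - A (k + 1) k * A (adjSwap k i) (k + 1)) / D (k + 1)
  else A (adjSwap k i) c

/-- The rational version of `swapStep`. -/
def swapStepRat (D : ℕ → ℤ) (A : ℕ → ℕ → ℤ) (k i c : ℕ) : ℚ :=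
  if c = k then
    (D k * A (adjSwap k i) (k + 1) + A (k + 1) k * A (adjSwap k i) k) / D (k + 1)
  else if c = k + 1 then
    (D (k + 2) * A (adjSwap k i) k - A (k + 1) k * A (adjSwap k i) (k + 1)) / D (k + 1)
  else A (adjSwap k i) c

theorem sum_range_eq_of_pair {f g : ℕ → ℚ} {k : ℕ} (hk : k + 1 < m)
    (hfg : ∀ j < m, j ≠ k → j ≠ k + 1 → f j = g j) (h : f k + f (k + 1) = g k + g (k + 1)) :
    ∑ j ∈ range m, f j = ∑ j ∈ range m, g j := by
  have e : ∀ f : ℕ → ℚ, ∑ j ∈ range m, f j =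
      f k + f (k + 1) + ∑ j ∈ ((range m).erase k).erase (k + 1), f j := fun f => by
    rw [← add_sum_erase (range m) f (mem_range.2 (by omega : k < m)),
      ← add_sum_erase ((range m).erase k) f (a := k + 1) (by simp; omega), add_assoc]
  rw [e f, e g, h]
  congr 1
  refine sum_congr rfl fun j hj => ?_
  simp only [mem_erase, mem_range] at hj
  exact hfg j hj.2.2 hj.2.1 hj.1

theorem Int.ediv_cast_of_eq {a b z : ℤ} (hb : b ≠ 0) (h : (a : ℚ) / b = z) :
    ((a / b : ℤ) : ℚ) = (a : ℚ) / b := by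
  have hb' : (b : ℚ) ≠ 0 := by exact_mod_cast hb
  rw [div_eq_iff hb'] at h
  have : a = z * b := by exact_mod_cast h
  subst this
  rw [Int.mul_ediv_cancel _ hb]
  push_cast
  field_simp

end

section
variable {m : ℕ} {G : (ℕ → ℤ) →ₗ[ℤ] (ℕ → ℤ) →ₗ[ℤ] ℤ} {D : ℕ → ℤ} {A : ℕ → ℕ → ℤ} {k : ℕ}

/-- The rational version of `swapDet`. -/
def swapDetRat (D : ℕ → ℤ) (A : ℕ → ℕ → ℤ) (k j : ℕ) : ℚ :=
  if j = k + 1 then (D k * D (k + 2) + A (k + 1) k * A (k + 1) k) / D (k + 1) else D j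

theorem Inv.swapDetRat_pos (h : Inv m G D A) (hk : k + 1 < m) {j : ℕ} (hj : j ≤ m) :
    0 < swapDetRat D A k j := by
  unfold swapDetRat
  split_ifs
  · have h0 := h.tri.pos k (by omega)
    have h1 := h.tri.pos (k + 1) (by omega)
    have h2 := h.tri.pos (k + 2) (by omega)
    have h3 := mul_self_nonneg (A (k + 1) k : ℚ)
    positivity
  · exact h.tri.pos j hj

theorem Inv.triangular_swapStepRat (h : Inv m G D A) (hk : k + 1 < m) :
    Triangular m (swapDetRat D A k) (swapStepRat D A k) := by
  have hne : (D (k + 1) : ℚ) ≠ 0 := (h.tri.pos (k + 1) (by omega)).ne'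
  have hd0 := h.diag (by omega : k < m)
  have hd1 := h.diag hk
  have hu := h.upper (by omega : k < m) hk (by omega)
  refine ⟨?_, fun j hj => h.swapDetRat_pos hk hj, fun j hj => ?_, fun i hi j hj hij => ?_⟩
  · simpa [swapDetRat] using h.tri.zero
  · rcases eq_or_ne j k with rfl | hjk
    · simp [swapStepRat, swapDetRat, adjSwap, hd1]
    rcases eq_or_ne j (k + 1) with rfl | hjk'
    · simp [swapStepRat, swapDetRat, adjSwap, hd0, hu]
      field_simp
    · simp [swapStepRat, swapDetRat, adjSwap, hjk, hjk', h.diag hj]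
  · rcases eq_or_ne j k with rfl | hjk
    · have e : adjSwap j i = i := by unfold adjSwap; split_ifs <;> omega
      simp [swapStepRat, e, h.upper hi hj hij, h.upper hi hk (by omega)]
    rcases eq_or_ne j (k + 1) with rfl | hjk'
    · rcases eq_or_ne i k with rfl | hik
      · simp [swapStepRat, adjSwap, hd1]
        left; ring
      · have e : adjSwap k i = i := by unfold adjSwap; split_ifs <;> omega
        simp [swapStepRat, e, h.upper hi hj hij, h.upper hi (by omega : k < m) (by omega)]
    · have hlt : adjSwap k i < j := by unfold adjSwap; split_ifs <;> omega
      simp [swapStepRat, hjk, hjk', h.upper (adjSwap_lt hk hi) hj hlt]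

theorem Inv.gramSum_swapStepRat (h : Inv m G D A) (hk : k + 1 < m) (a l : ℕ) :
    gramSum m (swapDetRat D A k) (swapStepRat D A k a) (swapStepRat D A k l) =
      gramSum m (fun j => D j) (fun j => A (adjSwap k a) j) (fun j => A (adjSwap k l) j) := by
  have h0 : (0 : ℚ) < D k := h.tri.pos k (by omega)
  have h1 : (0 : ℚ) < D (k + 1) := h.tri.pos (k + 1) (by omega)
  have h2 : (0 : ℚ) < D (k + 2) := h.tri.pos (k + 2) (by omega)
  have h3 := mul_self_nonneg (A (k + 1) k : ℚ)
  have h4 : (0 : ℚ) < D k * D (k + 2) + A (k + 1) k * A (k + 1) k := by positivity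
  refine sum_range_eq_of_pair hk (fun j hj hjk hjk' => ?_) ?_
  · simp [swapStepRat, swapDetRat, hjk, hjk']
  · have e2 : k + 1 + 1 = k + 2 := rfl
    have n1 : k ≠ k + 1 := by omega
    have n2 : k + 2 ≠ k + 1 := by omega
    have n3 : k + 1 ≠ k := by omega
    simp only [swapStepRat, swapDetRat, if_pos, e2, if_neg n1, if_neg n2, if_neg n3]
    generalize (D k : ℚ) = d0 at *
    generalize (D (k + 1) : ℚ) = d1 at *
    generalize (D (k + 2) : ℚ) = d2 at *
    generalize (A (k + 1) k : ℚ) = μ at *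
    have h5 := h4.ne'
    field_simp
    ring

theorem Inv.cast_swapStep (h : Inv m G D A) (hk : k + 1 < m) {i c : ℕ} (hi : i < m) (hc : c < m) :
    (swapStep D A k i c : ℚ) = swapStepRat D A k i c := by
  obtain ⟨z, hz⟩ := (h.triangular_swapStepRat hk).exists_int (fun a ha l hl =>
    ⟨_, (h.gramSum_swapStepRat hk a l).trans
      (h.gram _ (adjSwap_lt hk ha) _ (adjSwap_lt hk hl))⟩) hi hc
  have hne : D (k + 1) ≠ 0 := by exact_mod_cast (h.tri.pos (k + 1) (by omega)).ne'
  unfold swapStep swapStepRat at *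
  split_ifs at * with h1 h2
  · rw [Int.ediv_cast_of_eq (z := z) hne (by rw [← hz]; push_cast; rfl)]
    push_cast; rfl
  · rw [Int.ediv_cast_of_eq (z := z) hne (by rw [← hz]; push_cast; rfl)]
    push_cast; rfl
  · rfl

theorem Inv.cast_swapDet (h : Inv m G D A) (hk : k + 1 < m) (j : ℕ) :
    (swapDet D A k j : ℚ) = swapDetRat D A k j := by
  have h1 := h.cast_swapStep hk (i := k) (c := k) (by omega) (by omega)
  have hd1 := h.diag hk
  unfold swapDet swapDetRat
  split_ifs
  · simpa [swapStep, swapStepRat, adjSwap, hd1] using h1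
  · rfl

theorem swapStep_coordinates (hk : k + 1 < m) (a : ℕ) :
    (fun c => swapStep D A k a (m + c)) = fun c => A (adjSwap k a) (m + c) := by
  funext c
  have n1 : m + c ≠ k := by omega
  have n2 : m + c ≠ k + 1 := by omega
  simp only [swapStep, if_neg n1, if_neg n2]

theorem Inv.swap (h : Inv m G D A) (hk : k + 1 < m) :
    Inv m G (swapDet D A k) (swapStep D A k) := by
  have ht := h.triangular_swapStepRat hk
  have hD : (fun j => (swapDet D A k j : ℚ)) = swapDetRat D A k := funext (h.cast_swapDet hk)
  refine ⟨?_, fun a ha l hl => ?_⟩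
  · rw [hD]
    refine ⟨ht.zero, ht.pos, fun j hj => ?_, fun i hi j hj hij => ?_⟩
    · rw [h.cast_swapStep hk hj hj]; exact ht.diag j hj
    · rw [h.cast_swapStep hk hi hj]; exact ht.upper i hi j hj hij
  · rw [hD, swapStep_coordinates hk, swapStep_coordinates hk, ← h.gram _ (adjSwap_lt hk ha) _ (adjSwap_lt hk hl),
      ← h.gramSum_swapStepRat hk]
    refine sum_congr rfl fun j hj => ?_
    rw [mem_range] at hj
    simp only []
    rw [h.cast_swapStep hk ha hj, h.cast_swapStep hk hl hj]

theorem normSq_swapStep (hk : k + 1 < m) (i : ℕ) :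
    normSq m G (swapStep D A k) i = normSq m G A (adjSwap k i) := by
  simp only [normSq, swapStep_coordinates hk]

/-- Row `k` is size-reduced. -/
def SizeReduced (D : ℕ → ℤ) (A : ℕ → ℕ → ℤ) (k : ℕ) : Prop :=
  ∀ j < k, 2 * |A k j| ≤ D (j + 1)

theorem Inv.swapDet_le (h : Inv m G D A) (hk : k + 1 < m) (hr : SizeReduced D A (k + 1))
    (hs : 2 * D (k + 2) * D k < D (k + 1) * D (k + 1)) :
    4 * swapDet D A k (k + 1) ≤ 3 * D (k + 1) := by
  have h1 : 0 < D (k + 1) := by exact_mod_cast h.tri.pos (k + 1) (by omega)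
  have h2 := h.cast_swapDet hk (k + 1)
  have h3 : (D (k + 1) : ℚ) ≠ 0 := by exact_mod_cast h1.ne'
  simp only [swapDetRat, if_true] at h2
  rw [eq_div_iff h3] at h2
  have h4 : swapDet D A k (k + 1) * D (k + 1) = D k * D (k + 2) + A (k + 1) k * A (k + 1) k := by
    exact_mod_cast h2
  have h5 := hr k (by omega)
  have h6 : 4 * (A (k + 1) k * A (k + 1) k) ≤ D (k + 1) * D (k + 1) := by
    rw [← abs_mul_abs_self]
    nlinarith [abs_nonneg (A (k + 1) k)]
  refine le_of_mul_le_mul_right ?_ h1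
  nlinarith

/-- The product of the determinants, the potential of the reduction. -/
def potential (m : ℕ) (D : ℕ → ℤ) : ℤ := ∏ j ∈ range m, D j

theorem Inv.potential_pos (h : Inv m G D A) : 0 < potential m D :=
  prod_pos fun j hj => by
    have := h.tri.pos j (mem_range.1 hj).le
    exact_mod_cast this

theorem Inv.potential_swap (h : Inv m G D A) (hk : k + 1 < m) (hr : SizeReduced D A (k + 1))
    (hs : 2 * D (k + 2) * D k < D (k + 1) * D (k + 1)) :
    4 * potential m (swapDet D A k) ≤ 3 * potential m D := by
  have e : ∀ D : ℕ → ℤ, potential m D = D (k + 1) * ∏ j ∈ (range m).erase (k + 1), D j :=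
    fun D => (mul_prod_erase _ _ (mem_range.2 hk)).symm
  have h1 : ∏ j ∈ (range m).erase (k + 1), swapDet D A k j =
      ∏ j ∈ (range m).erase (k + 1), D j :=
    prod_congr rfl fun j hj => by simp [swapDet, (mem_erase.1 hj).1]
  have h2 : 0 ≤ ∏ j ∈ (range m).erase (k + 1), D j := prod_nonneg fun j hj => by
    have := h.tri.pos j (mem_range.1 (mem_of_mem_erase hj)).le
    exact_mod_cast this.le
  rw [e, e, h1, ← mul_assoc, ← mul_assoc]
  exact mul_le_mul_of_nonneg_right (h.swapDet_le hk hr hs) h2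

theorem Inv.sq_le (h : Inv m G D A) {i j : ℕ} (hi : i < m) (hj : j < m) :
    A i j * A i j ≤ D (j + 1) * D j * normSq m G A i := by
  have h1 : (0 : ℚ) < D (j + 1) := h.tri.pos (j + 1) hj
  have h0 : (0 : ℚ) < D j := h.tri.pos j hj.le
  have h2 : ((A i j : ℚ) * A i j) / (D (j + 1) * D j) ≤ normSq m G A i := by
    rw [normSq, ← h.gram i hi i hi]
    refine single_le_sum (f := fun j => (A i j : ℚ) * A i j / (D (j + 1) * D j))
      (fun c hc => ?_) (mem_range.2 hj)
    have h1 := h.tri.pos (c + 1) (mem_range.1 hc)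
    have h0 := h.tri.pos c (mem_range.1 hc).le
    exact div_nonneg (mul_self_nonneg _) (mul_pos h1 h0).le
  rw [div_le_iff₀ (by positivity)] at h2
  have : A i j * A i j ≤ normSq m G A i * (D (j + 1) * D j) := by exact_mod_cast h2
  linarith

theorem Inv.normSq_le (h : Inv m G D A) {i : ℕ} (hi : i < m) (hr : SizeReduced D A i) {B : ℤ}
    (hB : ∀ j ≤ m, D j ≤ B) : normSq m G A i ≤ m * B := by
  have h2 : (normSq m G A i : ℚ) ≤ m * B := by
    rw [normSq, ← h.gram i hi i hi]
    refine (sum_le_card_nsmul (range m) _ (B : ℚ) fun j hj => ?_).trans_eq (by simp)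
    have hj' := mem_range.1 hj
    have h1 : (0 : ℚ) < D (j + 1) := h.tri.pos (j + 1) hj'
    have h0 : (0 : ℚ) < D j := h.tri.pos j hj'.le
    have h0' : (1 : ℚ) ≤ D j := by
      have : 0 < D j := by exact_mod_cast h0
      exact_mod_cast this
    have hb : (D (j + 1) : ℚ) ≤ B := by exact_mod_cast hB (j + 1) hj'
    have hle : |(A i j : ℚ)| ≤ D (j + 1) := by
      rcases lt_trichotomy j i with hji | rfl | hji
      · have h3 := hr j hji
        have h4 := abs_nonneg (A i j)
        have : |A i j| ≤ D (j + 1) := by linarith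
        exact_mod_cast this
      · rw [h.diag hi, abs_of_pos h1]
      · rw [h.upper hi hj' hji]
        simpa using h1.le
    rw [div_le_iff₀ (by positivity), ← abs_mul_abs_self]
    calc |(A i j : ℚ)| * |(A i j : ℚ)| ≤ D (j + 1) * D (j + 1) :=
          mul_le_mul hle hle (abs_nonneg _) h1.le
      _ ≤ B * (D (j + 1) * 1) := by rw [mul_one]; exact mul_le_mul_of_nonneg_right hb h1.le
      _ ≤ B * (D (j + 1) * D j) := by
          have : (0 : ℚ) ≤ B := h1.le.trans hb
          gcongr
  exact_mod_cast h2

/-- The bound on the first vector of a reduced basis. -/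
theorem pow_le_of_reduced {n : ℕ} (h0 : D 0 = 1) (hpos : ∀ j ≤ n + 1, 0 < D j)
    (hs : ∀ i < n, D (i + 1) * D (i + 1) ≤ 2 * D (i + 2) * D i) :
    D 1 ^ (n + 1) ≤ 2 ^ (∑ i ∈ range (n + 1), i) * D (n + 1) := by
  have h1 : ∀ j ≤ n, D 1 * D j ≤ 2 ^ j * D (j + 1) := by
    intro j hj
    induction j with
    | zero => simp [h0]
    | succ j ih =>
      have ih := ih (by omega)
      have hp := hpos j (by omega)
      have hp1 := hpos (j + 1) (by omega)
      have hs' := hs j (by omega)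
      have h2 : (0 : ℤ) < 2 ^ j := by positivity
      refine le_of_mul_le_mul_right ?_ hp
      calc D 1 * D (j + 1) * D j = D 1 * D j * D (j + 1) := by ring
        _ ≤ 2 ^ j * D (j + 1) * D (j + 1) := mul_le_mul_of_nonneg_right ih hp1.le
        _ = 2 ^ j * (D (j + 1) * D (j + 1)) := by ring
        _ ≤ 2 ^ j * (2 * D (j + 2) * D j) := mul_le_mul_of_nonneg_left hs' h2.le
        _ = 2 ^ (j + 1) * D (j + 1 + 1) * D j := by ring
  have h3 : ∀ j ≤ n, D 1 ^ (j + 1) ≤ 2 ^ (∑ i ∈ range (j + 1), i) * D (j + 1) := by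
    intro j hj
    induction j with
    | zero => simp
    | succ j ih =>
      have ih := ih (by omega)
      have h4 := h1 (j + 1) hj
      have hp := hpos 1 (by omega)
      rw [sum_range_succ, pow_succ (D 1) (j + 1), pow_add 2]
      calc D 1 ^ (j + 1) * D 1 ≤ 2 ^ (∑ i ∈ range (j + 1), i) * D (j + 1) * D 1 :=
            mul_le_mul_of_nonneg_right ih hp.le
        _ = 2 ^ (∑ i ∈ range (j + 1), i) * (D 1 * D (j + 1)) := by ring
        _ ≤ 2 ^ (∑ i ∈ range (j + 1), i) * (2 ^ (j + 1) * D (j + 1 + 1)) := by gcongr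
        _ = _ := by ring
  exact h3 n le_rfl

/-- The integer nearest to `x / d`. -/
def nearest (x d : ℤ) : ℤ := (2 * x + d) / (2 * d)

theorem abs_sub_nearest_mul_le {x d : ℤ} (hd : 0 < d) : 2 * |x - nearest x d * d| ≤ d := by
  have h1 := Int.mul_ediv_add_emod (2 * x + d) (2 * d)
  have h2 := Int.emod_nonneg (2 * x + d) (by omega : 2 * d ≠ 0)
  have h3 := Int.emod_lt_of_pos (2 * x + d) (by omega : 0 < 2 * d)
  have h4 : |2 * (x - nearest x d * d)| ≤ d := by
    unfold nearest
    rw [abs_le]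
    constructor <;> nlinarith
  rwa [abs_mul, abs_two] at h4

theorem abs_nearest_le {x d : ℤ} (hd : 0 < d) : |nearest x d| ≤ |x| + 1 := by
  have h1 := abs_sub_nearest_mul_le (x := x) hd
  have h2 : |nearest x d * d| ≤ |x| + |x - nearest x d * d| := by
    have := abs_sub x (x - nearest x d * d)
    simpa using this
  rw [abs_mul, abs_of_pos hd] at h2
  have h3 := abs_nonneg x
  by_contra! h4
  have h5 : (|x| + 2) * d ≤ |nearest x d| * d := mul_le_mul_of_nonneg_right (by omega) hd.le
  nlinarith

end

/-- The form `κ ∑ i < n, (V xᵢ - bᵢ xₙ) (V yᵢ - bᵢ yₙ) + E xₙ yₙ`. -/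
def approxForm (n : ℕ) (κ V E : ℤ) (b : ℕ → ℤ) : (ℕ → ℤ) →ₗ[ℤ] (ℕ → ℤ) →ₗ[ℤ] ℤ :=
  let ℓ : ℕ → (ℕ → ℤ) →ₗ[ℤ] ℤ := fun i => V • LinearMap.proj i - b i • LinearMap.proj n
  κ • ∑ i ∈ range n, (ℓ i).smulRight (ℓ i) +
    E • (LinearMap.proj n : (ℕ → ℤ) →ₗ[ℤ] ℤ).smulRight (LinearMap.proj n)

section

variable {n : ℕ} {κ V E : ℤ} {b : ℕ → ℤ}

theorem approxForm_apply (x y : ℕ → ℤ) : approxForm n κ V E b x y =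
    κ * ∑ i ∈ range n, (V * x i - b i * x n) * (V * y i - b i * y n) + E * (x n * y n) := by
  simp [approxForm, LinearMap.sum_apply]

/-- The determinants of the initial basis. -/
def initDet (n : ℕ) (κ V E : ℤ) (j : ℕ) : ℤ :=
  if j ≤ n then (κ * V ^ 2) ^ j else (κ * V ^ 2) ^ n * E

/-- The coefficients and coordinates of the initial basis. -/
def initMatrix (n : ℕ) (κ V E : ℤ) (b : ℕ → ℤ) (k c : ℕ) : ℤ :=
  if c < n then
    (κ * V ^ 2) ^ c * (κ * V) * ((if c = k then V else 0) - if k = n then b c else 0)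
  else if c = n then (if k = n then (κ * V ^ 2) ^ n * E else 0)
  else if c = n + 1 + k then 1 else 0

theorem initMatrix_coordinates (k : ℕ) :
    (fun c => initMatrix n κ V E b k (n + 1 + c)) = Pi.single k 1 := by
  funext c
  have n1 : ¬ n + 1 + c < n := by omega
  have n2 : ¬ n + 1 + c = n := by omega
  simp only [initMatrix, if_neg n1, if_neg n2, Pi.single_apply, Nat.add_left_cancel_iff]

theorem inv_init (hκ : 0 < κ) (hV : 0 < V) (hE : 0 < E) :
    Inv (n + 1) (approxForm n κ V E b) (initDet n κ V E) (initMatrix n κ V E b) := by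
  have hK : 0 < κ * V ^ 2 := by positivity
  refine ⟨⟨by simp [initDet], fun j _ => ?_, fun j hj => ?_, fun i hi j hj hij => ?_⟩,
    fun k hk l hl => ?_⟩
  · simp only [initDet]
    split_ifs <;> exact_mod_cast (by positivity)
  · rcases (by omega : j < n ∨ j = n) with hjn | rfl
    · simp [initMatrix, initDet, hjn, hjn.ne]
      ring
    · simp [initMatrix, initDet]
  · rcases (by omega : j < n ∨ j = n) with hjn | rfl
    · have hin : i ≠ n := by omega
      simp [initMatrix, hjn, hij.ne', hin]
    · simp [initMatrix, hij.ne]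
  · rw [initMatrix_coordinates, initMatrix_coordinates, approxForm_apply, gramSum, sum_range_succ,
      mul_sum]
    push_cast
    have hκ' : (κ : ℚ) ≠ 0 := by exact_mod_cast hκ.ne'
    have hV' : (V : ℚ) ≠ 0 := by exact_mod_cast hV.ne'
    have hE' : (E : ℚ) ≠ 0 := by exact_mod_cast hE.ne'
    congr 1
    · refine sum_congr rfl fun j hj => ?_
      have hj' := mem_range.1 hj
      have e : ∀ k, (V : ℚ) * ((Pi.single k (1 : ℤ) : ℕ → ℤ) j : ℤ) -
          b j * ((Pi.single k (1 : ℤ) : ℕ → ℤ) n : ℤ) =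
          (if j = k then (V : ℚ) else 0) - if k = n then (b j : ℚ) else 0 := fun k => by
        simp [Pi.single_apply, eq_comm]
      rw [e, e]
      simp only [initMatrix, initDet, if_pos hj', if_pos (Nat.succ_le_of_lt hj'), if_pos hj'.le]
      push_cast
      generalize (if j = k then (V : ℚ) else 0) - (if k = n then (b j : ℚ) else 0) = p
      generalize (if j = l then (V : ℚ) else 0) - (if l = n then (b j : ℚ) else 0) = q
      rw [pow_succ]
      field_simp
      ring
    · by_cases hkn : k = n <;> by_cases hln : l = n
      · subst hkn; subst hln
        simp [initMatrix, initDet]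
        field_simp
      all_goals simp [initMatrix, hkn, hln]

theorem sq_coord_le (hκ : 0 < κ) (hE : 0 < E) (x : ℕ → ℤ) :
    (∀ i < n, κ * (V * x i - b i * x n) ^ 2 ≤ approxForm n κ V E b x x) ∧
      E * x n ^ 2 ≤ approxForm n κ V E b x x := by
  rw [approxForm_apply]
  have h1 : ∀ i ∈ range n, 0 ≤ (V * x i - b i * x n) * (V * x i - b i * x n) :=
    fun i _ => mul_self_nonneg _
  have h2 := sum_nonneg h1
  have h3 := mul_self_nonneg (x n)
  constructor
  · intro i hi
    have h4 := single_le_sum h1 (mem_range.2 hi)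
    nlinarith [mul_le_mul_of_nonneg_left h4 hκ.le, mul_nonneg hE.le h3]
  · nlinarith [mul_nonneg hκ.le h2]

/-- Bounds for the numbers in the reduction: all parameters have at most `τ` digits. -/
structure ParamBound (n τ : ℕ) (κ V E : ℤ) (b : ℕ → ℤ) : Prop where
  one_le : 1 ≤ τ
  κ_pos : 0 < κ
  V_pos : 0 < V
  E_pos : 0 < E
  κ_le : κ ≤ 2 ^ τ
  V_le : V ≤ 2 ^ τ
  E_le : E ≤ 2 ^ τ
  b_lt : ∀ i < n, |b i| < 2 ^ τ

variable {τ : ℕ}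

theorem ParamBound.K_le (h : ParamBound n τ κ V E b) : κ * V ^ 2 ≤ 2 ^ (3 * τ) := by
  have h1 := h.κ_le
  have h2 := h.V_le
  have h3 := h.κ_pos.le
  have h4 := h.V_pos.le
  calc κ * V ^ 2 ≤ 2 ^ τ * (2 ^ τ) ^ 2 := by gcongr
    _ = 2 ^ (3 * τ) := by ring

theorem ParamBound.K_pow_le (h : ParamBound n τ κ V E b) {j a : ℕ} (hj : j ≤ a) :
    (κ * V ^ 2) ^ j ≤ 2 ^ (3 * τ * a) := by
  have h1 := h.κ_pos
  have h2 := h.V_pos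
  calc (κ * V ^ 2) ^ j ≤ (2 ^ (3 * τ)) ^ j := pow_le_pow_left₀ (by positivity) h.K_le j
    _ = 2 ^ (3 * τ * j) := by rw [← pow_mul]
    _ ≤ 2 ^ (3 * τ * a) := pow_le_pow_right₀ (by norm_num) (Nat.mul_le_mul_left _ hj)

theorem ParamBound.initDet_le (h : ParamBound n τ κ V E b) (j : ℕ) :
    initDet n κ V E j ≤ 2 ^ (3 * τ * (n + 1)) := by
  unfold initDet
  have h1 := h.κ_pos
  have h2 := h.V_pos
  split_ifs with hj
  · exact h.K_pow_le (by omega)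
  · calc (κ * V ^ 2) ^ n * E ≤ 2 ^ (3 * τ * n) * 2 ^ τ :=
        mul_le_mul (h.K_pow_le le_rfl) h.E_le h.E_pos.le (by positivity)
      _ = 2 ^ (3 * τ * n + τ) := (pow_add _ _ _).symm
      _ ≤ 2 ^ (3 * τ * (n + 1)) := pow_le_pow_right₀ (by norm_num) (by rw [mul_add]; omega)

theorem ParamBound.normSq_init_le (h : ParamBound n τ κ V E b) {k : ℕ} (hk : k < n + 1) :
    normSq (n + 1) (approxForm n κ V E b) (initMatrix n κ V E b) k ≤
      ((n + 1 : ℕ) : ℤ) * 2 ^ (3 * τ * (n + 1)) := by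
  have h1 := h.κ_pos
  have h2 := h.V_pos
  have hp : (1 : ℤ) ≤ 2 ^ τ := one_le_pow₀ (by norm_num)
  have h3 : (2 : ℤ) ^ (3 * τ) ≤ 2 ^ (3 * τ * (n + 1)) :=
    pow_le_pow_right₀ (by norm_num) (Nat.le_mul_of_pos_right _ (by omega))
  have hE : E ≤ 2 ^ (3 * τ) :=
    h.E_le.trans (pow_le_pow_right₀ (by norm_num) (by omega))
  rw [normSq, initMatrix_coordinates, approxForm_apply]
  have h4 : ∀ i ∈ range n, κ * ((V * (Pi.single k (1 : ℤ) : ℕ → ℤ) i -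
      b i * (Pi.single k (1 : ℤ) : ℕ → ℤ) n) * (V * (Pi.single k (1 : ℤ) : ℕ → ℤ) i -
      b i * (Pi.single k (1 : ℤ) : ℕ → ℤ) n)) ≤ 2 ^ (3 * τ) := by
    intro i hi
    have hi := mem_range.1 hi
    have h5 : |V * (Pi.single k (1 : ℤ) : ℕ → ℤ) i - b i * (Pi.single k (1 : ℤ) : ℕ → ℤ) n| ≤
        2 ^ τ := by
      rcases (by omega : k < n ∨ k = n) with hkn | rfl
      · rw [Pi.single_eq_of_ne hkn.ne' (M := fun _ => ℤ)]
        by_cases hik : i = k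
        · subst hik
          simpa [abs_of_pos h2] using h.V_le
        · simp [Pi.single_eq_of_ne hik]
      · simpa [Pi.single_eq_of_ne hi.ne] using (h.b_lt i hi).le
    rw [← abs_mul_abs_self]
    calc κ * (_ * _) ≤ 2 ^ τ * (2 ^ τ * 2 ^ τ) := by
          have := h.κ_le
          gcongr
      _ = 2 ^ (3 * τ) := by ring
  have h6 := sum_le_card_nsmul _ _ _ h4
  have h7 : E * ((Pi.single k (1 : ℤ) : ℕ → ℤ) n * (Pi.single k (1 : ℤ) : ℕ → ℤ) n) ≤
      2 ^ (3 * τ) := by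
    by_cases hnk : n = k
    · subst hnk; simpa using hE
    · simp [Pi.single_eq_of_ne hnk]
  rw [mul_sum]
  rw [card_range, nsmul_eq_mul] at h6
  push_cast
  nlinarith

/-- The bound for the entries of the matrix between the steps of the reduction. -/
theorem ParamBound.abs_le (h : ParamBound n τ κ V E b) {D : ℕ → ℤ} {A : ℕ → ℕ → ℤ}
    (hI : Inv (n + 1) (approxForm n κ V E b) D A) (hD : ∀ j ≤ n + 1, D j ≤ 2 ^ (3 * τ * (n + 1)))
    {k c : ℕ} (hk : k < n + 1) (hN : normSq (n + 1) (approxForm n κ V E b) A k ≤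
      ((n + 1 : ℕ) : ℤ) * 2 ^ (3 * τ * (n + 1))) (hc : c < 2 * (n + 1)) :
    |A k c| ≤ 2 ^ (5 * τ * (n + 1)) := by
  have hτ := h.one_le
  have hX : normSq (n + 1) (approxForm n κ V E b) A k ≤ 2 ^ (4 * τ * (n + 1)) := by
    refine hN.trans ?_
    calc ((n + 1 : ℕ) : ℤ) * 2 ^ (3 * τ * (n + 1)) ≤ 2 ^ (n + 1) * 2 ^ (3 * τ * (n + 1)) := by
          gcongr
          exact_mod_cast (Nat.lt_two_pow_self (n := n + 1)).le
      _ = 2 ^ (n + 1 + 3 * τ * (n + 1)) := (pow_add _ _ _).symm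
      _ ≤ 2 ^ (4 * τ * (n + 1)) := pow_le_pow_right₀ (by norm_num) (by nlinarith)
  by_cases hcm : c < n + 1
  · have h1 := hI.sq_le hk hcm
    have h2 : 0 < D c := by exact_mod_cast hI.tri.pos c hcm.le
    have h3 : 0 < D (c + 1) := by exact_mod_cast hI.tri.pos (c + 1) hcm
    have h4 := hD c hcm.le
    have h5 := hD (c + 1) hcm
    refine abs_le_of_sq_le_sq ?_ (by positivity)
    calc A k c ^ 2 = A k c * A k c := sq _
      _ ≤ D (c + 1) * D c * normSq (n + 1) (approxForm n κ V E b) A k := h1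
      _ ≤ D (c + 1) * D c * 2 ^ (4 * τ * (n + 1)) := by gcongr
      _ ≤ 2 ^ (3 * τ * (n + 1)) * 2 ^ (3 * τ * (n + 1)) * 2 ^ (4 * τ * (n + 1)) := by gcongr
      _ = (2 ^ (5 * τ * (n + 1))) ^ 2 := by rw [← pow_add, ← pow_add, ← pow_mul]; ring
  · obtain ⟨i, rfl⟩ : ∃ i, c = n + 1 + i := ⟨c - (n + 1), by omega⟩
    set x : ℕ → ℤ := fun c => A k (n + 1 + c) with hx
    have hsq : (2 : ℤ) ^ (4 * τ * (n + 1)) = (2 ^ (2 * τ * (n + 1))) ^ 2 := by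
      rw [← pow_mul]; ring_nf
    obtain ⟨h1, h2⟩ := sq_coord_le (V := V) (b := b) (n := n) h.κ_pos h.E_pos x
    have h3 : |x n| ≤ 2 ^ (2 * τ * (n + 1)) := by
      refine abs_le_of_sq_le_sq ?_ (by positivity)
      rw [← hsq]
      refine le_trans ?_ (h2.trans hX)
      have := h.E_pos
      nlinarith [sq_nonneg (x n)]
    change |x i| ≤ _
    rcases (by omega : i < n ∨ i = n) with hin | rfl
    · have h4 : |V * x i - b i * x n| ≤ 2 ^ (2 * τ * (n + 1)) := by
        refine abs_le_of_sq_le_sq ?_ (by positivity)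
        rw [← hsq]
        refine le_trans ?_ ((h1 i hin).trans hX)
        have := h.κ_pos
        nlinarith [sq_nonneg (V * x i - b i * x n)]
      have h5 : |V * x i| ≤ |V * x i - b i * x n| + |b i| * |x n| := by
        rw [← abs_mul]
        have := abs_add_le (V * x i - b i * x n) (b i * x n)
        simpa using this
      have h6 : |x i| ≤ |V * x i| := by
        rw [abs_mul, abs_of_pos h.V_pos]
        have := h.V_pos
        nlinarith [abs_nonneg (x i)]
      have h7 := h.b_lt i hin
      calc |x i| ≤ 2 ^ (2 * τ * (n + 1)) + |b i| * 2 ^ (2 * τ * (n + 1)) := by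
            refine h6.trans (h5.trans ?_)
            gcongr
        _ = (|b i| + 1) * 2 ^ (2 * τ * (n + 1)) := by ring
        _ ≤ 2 ^ τ * 2 ^ (2 * τ * (n + 1)) := by gcongr; omega
        _ = 2 ^ (τ + 2 * τ * (n + 1)) := (pow_add _ _ _).symm
        _ ≤ _ := pow_le_pow_right₀ (by norm_num) (by nlinarith)
    · exact h3.trans (pow_le_pow_right₀ (by norm_num) (by nlinarith))

theorem Inv.normSq_zero {m : ℕ} {G : (ℕ → ℤ) →ₗ[ℤ] (ℕ → ℤ) →ₗ[ℤ] ℤ} {D : ℕ → ℤ} {A : ℕ → ℕ → ℤ}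
    (h : Inv m G D A) (hm : 0 < m) : normSq m G A 0 = D 1 := by
  have h1 : (D 1 : ℚ) ≠ 0 := (h.tri.pos 1 hm).ne'
  have h2 : (normSq m G A 0 : ℚ) = D 1 := by
    rw [normSq, ← h.gram 0 hm 0 hm, gramSum, sum_eq_single_of_mem 0 (mem_range.2 hm)]
    · have := h.tri.zero
      simp only [h.diag hm, this, zero_add, mul_one]
      field_simp
    · intro j hj hj0
      rw [h.upper hm (mem_range.1 hj) (by omega)]
      simp
  exact_mod_cast h2

/-- The first vector of a reduced basis solves the approximation problem. -/
theorem approx_of_reduced {e f : ℤ} (he : 0 < e) (hf : 0 < f) (hV : 0 < V)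
    (hκ : κ = f ^ (2 * (n + 1)) * 2 ^ (∑ i ∈ range (n + 1), i))
    (hE : E = V ^ 2 * e ^ (2 * (n + 1))) {D : ℕ → ℤ} {A : ℕ → ℕ → ℤ}
    (hI : Inv (n + 1) (approxForm n κ V E b) D A) (hD : D (n + 1) = (κ * V ^ 2) ^ n * E)
    (hs : ∀ i < n, D (i + 1) * D (i + 1) ≤ 2 * D (i + 2) * D i) :
    (∀ i < n, (V * A 0 (n + 1 + i) - b i * A 0 (n + 1 + n)) ^ 2 * f ^ 2 ≤ V ^ 2 * e ^ 2) ∧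
      A 0 (n + 1 + n) ^ 2 * e ^ (2 * n) ≤ 2 ^ (∑ i ∈ range (n + 1), i) * f ^ (2 * n) ∧
      ∃ i ≤ n, A 0 (n + 1 + i) ≠ 0 := by
  have hκ0 : 0 < κ := by rw [hκ]; positivity
  have hE0 : 0 < E := by rw [hE]; positivity
  have hpos : ∀ j ≤ n + 1, 0 < D j := fun j hj => by exact_mod_cast hI.tri.pos j hj
  have h1 := pow_le_of_reduced (by exact_mod_cast hI.tri.zero) hpos hs
  set S := ∑ i ∈ range (n + 1), i with hS
  have hD1 := hpos 1 (by omega)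
  have h2 : D 1 * f ^ 2 ≤ κ * V ^ 2 * e ^ 2 := by
    refine le_of_pow_le_pow_left₀ (Nat.succ_ne_zero n) (by positivity) ?_
    calc (D 1 * f ^ 2) ^ (n + 1) = D 1 ^ (n + 1) * f ^ (2 * (n + 1)) := by
          rw [mul_pow, ← pow_mul]
      _ ≤ 2 ^ S * D (n + 1) * f ^ (2 * (n + 1)) := by gcongr
      _ = (κ * V ^ 2) ^ n * (f ^ (2 * (n + 1)) * 2 ^ S) * V ^ 2 * e ^ (2 * (n + 1)) := by
          rw [hD, hE]; ring
      _ = (κ * V ^ 2 * e ^ 2) ^ (n + 1) := by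
          rw [← hκ]; ring
  have h3 := hI.normSq_zero (Nat.succ_pos n)
  obtain ⟨h4, h5⟩ := sq_coord_le (V := V) (b := b) (n := n) hκ0 hE0 fun c => A 0 (n + 1 + c)
  rw [normSq] at h3
  rw [h3] at h4 h5
  refine ⟨fun i hi => ?_, ?_, ?_⟩
  · have h6 := h4 i hi
    refine le_of_mul_le_mul_left ?_ hκ0
    calc κ * ((V * A 0 (n + 1 + i) - b i * A 0 (n + 1 + n)) ^ 2 * f ^ 2)
        = κ * (V * A 0 (n + 1 + i) - b i * A 0 (n + 1 + n)) ^ 2 * f ^ 2 := by ring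
      _ ≤ D 1 * f ^ 2 := by gcongr
      _ ≤ κ * (V ^ 2 * e ^ 2) := by linarith
  · have h6 : 0 < V ^ 2 * e ^ 2 * f ^ 2 := by positivity
    refine le_of_mul_le_mul_left ?_ h6
    calc V ^ 2 * e ^ 2 * f ^ 2 * (A 0 (n + 1 + n) ^ 2 * e ^ (2 * n))
        = E * A 0 (n + 1 + n) ^ 2 * f ^ 2 := by rw [hE]; ring
      _ ≤ D 1 * f ^ 2 := by gcongr
      _ ≤ κ * V ^ 2 * e ^ 2 := h2
      _ = V ^ 2 * e ^ 2 * f ^ 2 * (2 ^ S * f ^ (2 * n)) := by rw [hκ]; ring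
  · by_contra! h6
    rw [approxForm_apply] at h3
    have h7 : A 0 (n + 1 + n) = 0 := h6 n le_rfl
    rw [sum_eq_zero fun i hi => ?_, h7] at h3
    · simp at h3; omega
    · rw [h6 i (mem_range.1 hi).le, h7]; ring

end
end LatticeReduction

namespace RAM

theorem Memory.write_array_same (M : Memory) (k : ℕ) (j x : ℤ) :
    M.write k j x k = Function.update (M k) j x := by
  funext j'
  by_cases h : j' = j <;> simp [Memory.write, h]

/-- The memories agree on all arrays outside a list. -/
def AgreeOff (S : List ℕ) (M M' : Memory) : Prop := ∀ k, k ∉ S → M' k = M k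

theorem AgreeOff.refl (S : List ℕ) (M : Memory) : AgreeOff S M M := fun _ _ => rfl

theorem AgreeOff.write {S : List ℕ} {M M' : Memory} (h : AgreeOff S M M') {k : ℕ} (hk : k ∈ S)
    (j x : ℤ) : AgreeOff S M (M'.write k j x) := fun k' hk' => by
  rw [Memory.write_array_ne _ _ _ (by rintro rfl; exact hk' hk), h k' hk']

theorem AgreeOff.trans {S S' : List ℕ} {M M' M'' : Memory} (h : AgreeOff S M M')
    (h' : AgreeOff S' M' M'') (hS : S' ⊆ S) : AgreeOff S M M'' := fun k hk => by
  rw [h' k fun hk' => hk (hS hk'), h k hk]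

end RAM

namespace LatticeReduction

open RAM Finset

/-- An array holds, row by row, the first `m` rows and `2 * m` columns of a matrix. -/
def Holds (m : ℕ) (a : ℤ → ℤ) (A : ℕ → ℕ → ℤ) : Prop :=
  ∀ i < m, ∀ c < 2 * m, a ((i : ℤ) * (2 * m : ℕ) + c) = A i c

theorem address_inj {w i i' c c' : ℕ} (hc : c < w) (hc' : c' < w) :
    (i : ℤ) * w + c = (i' : ℤ) * w + c' ↔ i = i' ∧ c = c' := by
  refine ⟨fun h => ?_, fun ⟨h, h'⟩ => by rw [h, h']⟩
  have h1 : c + w * i = c' + w * i' := by zify; linarith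
  have h2 : i = i' := by
    have := congrArg (· / w) h1
    simpa [Nat.add_mul_div_left _ _ (by omega : 0 < w), Nat.div_eq_of_lt hc,
      Nat.div_eq_of_lt hc'] using this
  subst h2
  exact ⟨rfl, by omega⟩

theorem Holds.congr {m : ℕ} {a : ℤ → ℤ} {A A' : ℕ → ℕ → ℤ} (h : Holds m a A)
    (hA : ∀ i < m, ∀ c < 2 * m, A i c = A' i c) : Holds m a A' := fun i hi c hc => by
  rw [h i hi c hc, hA i hi c hc]

theorem Holds.update {m : ℕ} {a : ℤ → ℤ} {A : ℕ → ℕ → ℤ} (h : Holds m a A) {i c : ℕ}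
    (hc : c < 2 * m) (x : ℤ) : Holds m (Function.update a ((i : ℤ) * (2 * m : ℕ) + c) x)
      fun i' c' => if i' = i ∧ c' = c then x else A i' c' := fun i' hi' c' hc' => by
  simp only [Function.update_apply, address_inj hc' hc]
  split_ifs
  exacts [rfl, h i' hi' c' hc']

/-- The entry of the matrix in array `4`; the number of columns is kept in variable `5`. -/
def cell (e₁ e₂ : Expr) : Expr := .read 4 (.op .add (.op .mul e₁ (var 5)) e₂)

/-- Assignment to an entry of the matrix. -/
def putCell (e₁ e₂ e : Expr) : Program := .write 4 (.op .add (.op .mul e₁ (var 5)) e₂) e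

@[simp] theorem eval_cell (M : Memory) (e₁ e₂ : Expr) :
    (cell e₁ e₂).eval M = M 4 (e₁.eval M * M 5 0 + e₂.eval M) := rfl

section

variable {b C C' : ℕ} {Q : Memory → Prop} {M : Memory}

theorem wp_putCell {e₁ e₂ e : Expr} (hM : M.Bounded b) (hC : b + 1 ≤ C) {w i c : ℕ} {x : ℤ}
    (h5 : M 5 0 = w) (h₁ : e₁.eval M = i) (h₂ : e₂.eval M = c) (h : e.eval M = x)
    (hQ : Q (M.write 4 ((i : ℤ) * w + c) x)) : WP C (putCell e₁ e₂ e) Q M := by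
  refine WP.write hM hC ?_
  simpa [h5, h₁, h₂, h] using hQ

theorem eval_cell_eq {m : ℕ} {A : ℕ → ℕ → ℤ} (hA : Holds m (M 4) A) (h5 : M 5 0 = (2 * m : ℕ))
    {e₁ e₂ : Expr} {i c : ℕ} (hi : i < m) (hc : c < 2 * m) (h₁ : e₁.eval M = i)
    (h₂ : e₂.eval M = c) : (cell e₁ e₂).eval M = A i c := by
  rw [eval_cell, h5, h₁, h₂, hA i hi c hc]

theorem eval_cell_var {m : ℕ} {A : ℕ → ℕ → ℤ} (hA : Holds m (M 4) A) (h5 : M 5 0 = (2 * m : ℕ))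
    {i c k₁ k₂ : ℕ} (hi : i < m) (hc : c < 2 * m) (h₁ : M k₁ 0 = i) (h₂ : M k₂ 0 = c) :
    (cell (var k₁) (var k₂)).eval M = A i c :=
  eval_cell_eq hA h5 hi hc h₁ h₂

/-- Row `var 7` minus `var 10` times row `var 18`. -/
def rowSubProg : Program :=
  forTo 9 (var 5) (putCell (var 7) (var 9)
    (.op .sub (cell (var 7) (var 9)) (.op .mul (var 10) (cell (var 18) (var 9)))))

theorem wp_rowSub {m : ℕ} {A : ℕ → ℕ → ℤ} {k j : ℕ} {r : ℤ} (hM : M.Bounded b) (hC : b + 1 ≤ C)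
    (hm : ((2 * m : ℕ) : ℤ) < 2 ^ b) (h5 : M 5 0 = (2 * m : ℕ)) (h7 : M 7 0 = k) (h10 : M 10 0 = r)
    (h18 : M 18 0 = j) (hA : Holds m (M 4) A) (hk : k < m) (hj : j < m) (hjk : j ≠ k)
    (hb : ∀ c < 2 * m, |A k c - r * A j c| < 2 ^ b) (hC' : (2 * m + 1) * C ≤ C')
    (hQ : ∀ M', M'.Bounded b → AgreeOff [4, 9] M M' → Holds m (M' 4) (rowSub A k j r) → Q M') :
    WP C' rowSubProg Q M := by
  refine WP.forTo (fun x M' => AgreeOff [4, 9] M M' ∧ Holds m (M' 4) fun i c =>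
    if i = k ∧ c < x then A k c - r * A j c else A i c) hC hm hM ?_ ?_ ?_ hC' ?_
  · exact ⟨(AgreeOff.refl _ M).write (by decide) _ _, by
      simpa [Memory.write_array_ne] using hA⟩
  · rintro x M' ⟨h, -⟩
    rw [eval_var, h 5 (by decide), h5]
  · rintro x hx M' hM' h9 ⟨h, hA'⟩
    have h5' : M' 5 0 = (2 * m : ℕ) := by rw [h 5 (by decide), h5]
    have h7' : M' 7 0 = k := by rw [h 7 (by decide), h7]
    have h10' : M' 10 0 = r := by rw [h 10 (by decide), h10]
    have h18' : M' 18 0 = j := by rw [h 18 (by decide), h18]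
    refine wp_putCell hM' hC h5' (i := k) (c := x) (x := A k x - r * A j x) h7' h9 ?_ ?_
    · rw [eval_sub, eval_mul, eval_cell_var hA' h5' hk hx h7' h9,
        eval_cell_var hA' h5' hj hx h18' h9]
      simp [hjk, h10']
    · refine ⟨hM'.write _ _ (hb x hx), by simpa [Memory.write_array_ne] using h9,
        (h.write (by decide) _ _).write (by decide) _ _, ?_⟩
      rw [Memory.write_array_ne _ _ _ (by decide), Memory.write_array_same]
      refine (hA'.update hx _).congr fun i hi c hc => ?_
      by_cases h1 : i = k <;> by_cases h2 : c = x
      · simp [h1, h2]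
      · simp [h1, h2, (by omega : c < x + 1 ↔ c < x)]
      · simp [h1]
      · simp [h1]
  · rintro M' hM' ⟨h, hA'⟩
    exact hQ M' hM' h (hA'.congr fun i hi c hc => by simp [rowSub, hc])

/-- Size reduction of row `var 7`. -/
def reduceRowProg : Program :=
  forTo 8 (var 7) (.seq (assign 18 (.op .sub (.op .sub (var 7) (var 8)) (.const 1)))
    (.seq (assign 10 (.op .div
        (.op .add (.op .mul (.const 2) (cell (var 7) (var 18))) (cell (var 18) (var 18)))
        (.op .mul (.const 2) (cell (var 18) (var 18)))))
      rowSubProg))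

variable {m : ℕ} {G : (ℕ → ℤ) →ₗ[ℤ] (ℕ → ℤ) →ₗ[ℤ] ℤ} {D : ℕ → ℤ} {A : ℕ → ℕ → ℤ} {U : ℤ}

theorem wp_reduceRow {k : ℕ} (hM : M.Bounded b) (hC : b + 1 ≤ C)
    (hm : ((2 * m : ℕ) : ℤ) < 2 ^ b) (h5 : M 5 0 = (2 * m : ℕ)) (h7 : M 7 0 = k)
    (hA : Holds m (M 4) A) (hk : k < m) (hI : Inv m G D A) (hU0 : 0 ≤ U)
    (hU : ∀ i < m, ∀ c < 2 * m, |A i c| ≤ U) (hUb : (U + 1) ^ (m + 1) < 2 ^ b)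
    (hC' : (2 * m + 1) ^ 2 * C ≤ C')
    (hQ : ∀ M' A', M'.Bounded b → AgreeOff [4, 8, 9, 10, 18] M M' → Holds m (M' 4) A' →
      Inv m G D A' → (∀ i, i ≠ k → A' i = A i) → SizeReduced D A' k → Q M') :
    WP C' reduceRowProg Q M := by
  have hC1 : b + 1 ≤ (2 * m + 1) * C := by nlinarith
  refine WP.forTo (N := k) (C := (2 * m + 1) * C) (fun x M' => AgreeOff [4, 8, 9, 10, 18] M M' ∧
    ∃ A', Holds m (M' 4) A' ∧ Inv m G D A' ∧ (∀ i, i ≠ k → A' i = A i) ∧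
      (∀ j < k, k ≤ j + x → 2 * |A' k j| ≤ D (j + 1)) ∧
      ∀ c < 2 * m, |A' k c| + 1 ≤ (U + 1) ^ (x + 1)) hC1
    (lt_of_le_of_lt (by exact_mod_cast (by omega)) hm) hM ?_ ?_ ?_ ?_ ?_
  · refine ⟨(AgreeOff.refl _ M).write (by decide) _ _, A, ?_, hI, fun _ _ => rfl,
      fun j hj hj' => by omega, fun c hc => ?_⟩
    · simpa [Memory.write_array_ne] using hA
    · simpa using hU k hk c hc
  · rintro x M' ⟨h, -⟩
    rw [eval_var, h 7 (by decide), h7]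
  · rintro x hx M' hM' h8 ⟨h, A', hA', hI', hrow, hred, hbd⟩
    obtain ⟨j, hj⟩ : ∃ j, k = j + x + 1 := ⟨k - x - 1, by omega⟩
    have hjm : j < m := by omega
    have hdiag := hI'.diag hjm
    have hpos : 0 < D (j + 1) := by exact_mod_cast hI'.tri.pos (j + 1) hjm
    have hpow : ∀ y ≤ m + 1, (U + 1) ^ y < 2 ^ b := fun y hy =>
      lt_of_le_of_lt (pow_le_pow_right₀ (by omega) hy) hUb
    have hr := abs_nearest_le (x := A' k j) hpos
    have hr' := hr.trans (hbd j (by omega))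
    have h7' : M' 7 0 = k := by rw [h 7 (by decide), h7]
    have h5' : M' 5 0 = (2 * m : ℕ) := by rw [h 5 (by decide), h5]
    have he1 : (Expr.op .sub (.op .sub (var 7) (var 8)) (.const 1)).eval M' = j := by
      simp only [eval_sub, eval_var, eval_const, h7', h8, hj]
      push_cast; ring
    refine WP.seq (WP.assign hM' hC1 ?_)
    rw [he1]
    have hM1 : (M'.write 18 0 j).Bounded b := hM'.write _ _ (by
      rw [abs_of_nonneg (by positivity)]
      exact lt_of_le_of_lt (by exact_mod_cast (by omega)) hm)
    set M1 := M'.write 18 0 j with hM1d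
    have hag1 : AgreeOff [18] M' M1 := (AgreeOff.refl _ M').write (by decide) _ _
    have h18 : M1 18 0 = j := by rw [hM1d, Memory.write_same]
    have hA1 : Holds m (M1 4) A' := by rw [hag1 4 (by decide)]; exact hA'
    have h51 : M1 5 0 = (2 * m : ℕ) := by rw [hag1 5 (by decide), h5']
    have h71 : M1 7 0 = k := by rw [hag1 7 (by decide), h7']
    refine WP.seq (WP.assign hM1 hC1 ?_)
    have he2 : (Expr.op .div
        (.op .add (.op .mul (.const 2) (cell (var 7) (var 18))) (cell (var 18) (var 18)))
        (.op .mul (.const 2) (cell (var 18) (var 18)))).eval M1 = nearest (A' k j) (D (j + 1)) := by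
      rw [eval_div, eval_add, eval_mul, eval_mul,
        eval_cell_var hA1 h51 hk (c := j) (by omega) h71 h18,
        eval_cell_var hA1 h51 hjm (c := j) (by omega) h18 h18, hdiag]
      rfl
    rw [he2]
    set r := nearest (A' k j) (D (j + 1)) with hrd
    have hM2 : (M1.write 10 0 r).Bounded b :=
      hM1.write _ _ (hr'.trans_lt (hpow _ (by omega)))
    have hag2 : AgreeOff [10, 18] M' (M1.write 10 0 r) :=
      ((AgreeOff.refl _ M').write (by decide) _ _).write (by decide) _ _
    have hbd' : ∀ c < 2 * m, |A' k c - r * A' j c| + 1 ≤ (U + 1) ^ (x + 1 + 1) := by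
      intro c hc
      have h1 := hbd c hc
      have h2 : |A' j c| ≤ U := by rw [hrow j (by omega)]; exact hU j hjm c hc
      have h3 : |A' k c - r * A' j c| ≤ |A' k c| + |r| * |A' j c| := by
        rw [← abs_mul]; exact abs_sub _ _
      have h4 : |r| * |A' j c| ≤ (U + 1) ^ (x + 1) * U :=
        mul_le_mul hr' h2 (abs_nonneg _) (by positivity)
      rw [pow_succ]
      linarith
    refine wp_rowSub hM2 hC hm (A := A') (k := k) (j := j) (r := r) ?_ ?_ ?_ ?_ ?_ hk hjm (by omega)
      (fun c hc => ?_) le_rfl ?_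
    · rw [hag2 5 (by decide), h5']
    · rw [hag2 7 (by decide), h7']
    · rw [Memory.write_same]
    · rw [Memory.write_array_ne _ _ _ (by decide), h18]
    · rw [hag2 4 (by decide)]; exact hA'
    · have h1 := hbd' c hc
      have h2 := hpow (x + 1 + 1) (by omega)
      linarith
    · intro M3 hM3 hag3 hA3
      have hag : AgreeOff [4, 9, 10, 18] M' M3 := fun a ha => by
        rw [hag3 a (by simp at ha ⊢; tauto), hag2 a (by simp at ha ⊢; tauto)]
      refine ⟨hM3, ?_, ?_, rowSub A' k j r, ?_, hI'.rowSub (by omega) hk r, fun i hi => ?_,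
        fun j' hj' hj'x => ?_, fun c hc => ?_⟩
      · rw [hag 8 (by decide), h8]
      · exact (h.trans hag (by decide)).write (by decide) _ _
      · rw [Memory.write_array_ne _ _ _ (by decide)]; exact hA3
      · rw [← hrow i hi]; funext c; simp [rowSub, hi]
      · simp only [rowSub, if_true]
        rcases (by omega : j' = j ∨ j < j') with rfl | hlt
        · rw [hdiag]; exact abs_sub_nearest_mul_le hpos
        · rw [hI'.upper hjm (by omega) hlt, mul_zero, sub_zero]
          exact hred j' hj' (by omega)
      · simpa [rowSub] using hbd' c hc
  · calc (k + 1) * ((2 * m + 1) * C) ≤ (2 * m + 1) * ((2 * m + 1) * C) :=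
        Nat.mul_le_mul_right _ (by omega)
      _ = (2 * m + 1) ^ 2 * C := by ring
      _ ≤ C' := hC'
  · rintro M' hM' ⟨h, A', hA', hI', hrow, hred, -⟩
    exact hQ M' A' hM' h hA' hI' hrow fun j hj => hred j hj (by omega)

end

/-- The vectors and determinants obey the bounds that hold throughout the reduction. -/
structure Good (m : ℕ) (G : (ℕ → ℤ) →ₗ[ℤ] (ℕ → ℤ) →ₗ[ℤ] ℤ) (B : ℤ) (D : ℕ → ℤ)
    (A : ℕ → ℕ → ℤ) : Prop where
  inv : Inv m G D A
  det_le : ∀ j ≤ m, D j ≤ B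
  norm_le : ∀ k < m, normSq m G A k ≤ m * B

/-- The word length `b` suffices for the numbers in the reduction. -/
structure WordBound (b m : ℕ) (G : (ℕ → ℤ) →ₗ[ℤ] (ℕ → ℤ) →ₗ[ℤ] ℤ) (B U : ℤ) : Prop where
  width : ((2 * m : ℕ) : ℤ) < 2 ^ b
  nonneg : 0 ≤ U
  entry_le : ∀ D A, Good m G B D A → ∀ k < m, ∀ c < 2 * m, |A k c| ≤ U
  pow_lt : (U + 1) ^ (m + 1) < 2 ^ b

section

variable {b C C' m : ℕ} {Q : Memory → Prop} {M : Memory}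
  {G : (ℕ → ℤ) →ₗ[ℤ] (ℕ → ℤ) →ₗ[ℤ] ℤ} {D : ℕ → ℤ} {A : ℕ → ℕ → ℤ} {B U : ℤ}

theorem WordBound.lt_of_le (h : WordBound b m G B U) {x : ℤ} (hx : x ≤ U) : x < 2 ^ b := by
  refine lt_of_le_of_lt ?_ h.pow_lt
  have := h.nonneg
  calc x ≤ U + 1 := by omega
    _ = (U + 1) ^ 1 := (pow_one _).symm
    _ ≤ (U + 1) ^ (m + 1) := pow_le_pow_right₀ (by omega) (by omega)

theorem WordBound.index_lt (h : WordBound b m G B U) {i : ℕ} (hi : i ≤ 2 * m) :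
    |(i : ℤ)| < 2 ^ b := by
  rw [abs_of_nonneg (by positivity)]
  exact lt_of_le_of_lt (by exact_mod_cast hi) h.width

/-- Size reduction of all rows. -/
def reduceAllProg : Program := forTo 7 (var 6) reduceRowProg

theorem wp_reduceAll (hM : M.Bounded b) (hC : b + 1 ≤ C) (hW : WordBound b m G B U)
    (h5 : M 5 0 = (2 * m : ℕ)) (h6 : M 6 0 = m) (hA : Holds m (M 4) A) (hG : Good m G B D A)
    (hC' : (2 * m + 1) ^ 3 * C ≤ C')
    (hQ : ∀ M' A', M'.Bounded b → AgreeOff [4, 7, 8, 9, 10, 18] M M' → Holds m (M' 4) A' →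
      Good m G B D A' → (∀ k < m, SizeReduced D A' k) → Q M') :
    WP C' reduceAllProg Q M := by
  have hC1 : b + 1 ≤ (2 * m + 1) ^ 2 * C := by nlinarith [Nat.zero_le (m * C), sq_nonneg m]
  refine WP.forTo (N := m) (C := (2 * m + 1) ^ 2 * C)
    (fun x M' => AgreeOff [4, 7, 8, 9, 10, 18] M M' ∧
      ∃ A', Holds m (M' 4) A' ∧ Good m G B D A' ∧ ∀ k < x, SizeReduced D A' k) hC1
    (lt_of_le_of_lt (by exact_mod_cast (by omega)) hW.width) hM ?_ ?_ ?_ ?_ ?_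
  · refine ⟨(AgreeOff.refl _ M).write (by decide) _ _, A, ?_, hG, fun k hk => by omega⟩
    simpa [Memory.write_array_ne] using hA
  · rintro x M' ⟨h, -⟩
    rw [eval_var, h 6 (by decide), h6]
  · rintro k hk M' hM' h7 ⟨h, A', hA', hG', hred⟩
    have h5' : M' 5 0 = (2 * m : ℕ) := by rw [h 5 (by decide), h5]
    refine wp_reduceRow hM' hC hW.width h5' h7 hA' hk hG'.inv hW.nonneg
      (hW.entry_le D A' hG') hW.pow_lt le_rfl ?_
    intro M'' A'' hM'' hag hA'' hI'' hrow hr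
    refine ⟨hM'', ?_, ?_, A'', ?_, ⟨hI'', hG'.det_le, fun i hi => ?_⟩, fun i hi => ?_⟩
    · rw [hag 7 (by decide), h7]
    · exact (h.trans hag (by decide)).write (by decide) _ _
    · rw [Memory.write_array_ne _ _ _ (by decide)]; exact hA''
    · rcases eq_or_ne i k with rfl | hik
      · exact hI''.normSq_le hi hr hG'.det_le
      · have := hG'.norm_le i hi
        rwa [normSq, ← hrow i hik] at this
    · rcases eq_or_ne i k with rfl | hik
      · exact hr
      · have := hred i (by omega)
        rwa [SizeReduced, ← hrow i hik] at this
  · calc (m + 1) * ((2 * m + 1) ^ 2 * C) ≤ (2 * m + 1) * ((2 * m + 1) ^ 2 * C) :=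
        Nat.mul_le_mul_right _ (by omega)
      _ = (2 * m + 1) ^ 3 * C := by ring
      _ ≤ C' := hC'
  · rintro M' hM' ⟨h, A', hA', hG', hred⟩
    exact hQ M' A' hM' h hA' hG' hred

/-- Search for an index at which the reduction condition fails; the successor of the index goes to
variable `11`, the determinant to variable `12`. -/
def searchProg : Program :=
  .seq (assign 11 (.const 0)) (.seq (assign 13 (.const 1)) (forTo 14 (var 0)
    (.seq (.branch (.op .sub (.op .mul (cell (var 14) (var 14)) (cell (var 14) (var 14)))
        (.op .mul (.op .mul (.const 2)
          (cell (.op .add (var 14) (.const 1)) (.op .add (var 14) (.const 1)))) (var 13)))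
        (.seq (assign 11 (.op .add (var 14) (.const 1))) (assign 12 (var 13))) .skip)
      (assign 13 (cell (var 14) (var 14))))))

theorem wp_search {n : ℕ} (hm : m = n + 1) (hM : M.Bounded b) (hC : b + 1 ≤ C)
    (hW : WordBound b m G B U) (h0 : M 0 0 = n) (h5 : M 5 0 = (2 * m : ℕ)) (hA : Holds m (M 4) A)
    (hG : Good m G B D A) (hC' : (2 * m + 1) * C ≤ C')
    (hQ : ∀ M', M'.Bounded b → AgreeOff [11, 12, 13, 14] M M' →
      (M' 11 0 = 0 ∧ ∀ i < n, D (i + 1) * D (i + 1) ≤ 2 * D (i + 2) * D i) ∨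
        (∃ i < n, M' 11 0 = (i + 1 : ℕ) ∧ M' 12 0 = D i ∧
          2 * D (i + 2) * D i < D (i + 1) * D (i + 1)) → Q M') :
    WP C' searchProg Q M := by
  have hCC : C ≤ C' := by nlinarith
  have hb0 : (1 : ℤ) < 2 ^ b :=
    lt_of_le_of_lt (by exact_mod_cast (by omega : 1 ≤ 2 * m)) hW.width
  have hD0 : D 0 = 1 := by exact_mod_cast hG.inv.tri.zero
  have hM1 : (M.write 11 0 0).Bounded b := hM.write _ _ (by simp)
  have hM2 : ((M.write 11 0 0).write 13 0 1).Bounded b := hM1.write _ _ (by simpa using hb0)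
  refine WP.seq (WP.assign hM (hC.trans hCC) ?_)
  refine WP.seq (WP.assign hM1 (hC.trans hCC) ?_)
  refine WP.forTo (N := n) (C := C)
    (fun x M' => AgreeOff [11, 12, 13, 14] M M' ∧ M' 13 0 = D x ∧
      ((M' 11 0 = 0 ∧ ∀ i < x, D (i + 1) * D (i + 1) ≤ 2 * D (i + 2) * D i) ∨
        (∃ i < x, M' 11 0 = (i + 1 : ℕ) ∧ M' 12 0 = D i ∧
          2 * D (i + 2) * D i < D (i + 1) * D (i + 1)))) hC
    (lt_of_le_of_lt (by exact_mod_cast (by omega)) hW.width) hM2 ?_ ?_ ?_ ?_ ?_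
  · refine ⟨(((AgreeOff.refl _ M).write (by decide) _ _).write (by decide) _ _).write
      (by decide) _ _, ?_, .inl ⟨?_, fun i hi => by omega⟩⟩ <;>
      simp [Memory.write_array_ne, Memory.write_same, hD0]
  · rintro x M' ⟨h, -⟩
    rw [eval_var, h 0 (by decide), h0]
  · rintro x hx M' hM' h14 ⟨h, h13, hcase⟩
    have h5' : M' 5 0 = (2 * m : ℕ) := by rw [h 5 (by decide), h5]
    have hA' : Holds m (M' 4) A := by rw [h 4 (by decide)]; exact hA
    have hd1 : A x x = D (x + 1) := hG.inv.diag (by omega)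
    have hd2 : A (x + 1) (x + 1) = D (x + 2) := hG.inv.diag (by omega)
    have hbd : |D (x + 1)| < 2 ^ b := by
      rw [← hd1]; exact hW.lt_of_le (hW.entry_le D A hG x (by omega) x (by omega))
    have hbd0 : |D x| < 2 ^ b := by rw [← h13]; exact hM' _ _
    have hx1 : (Expr.op .add (var 14) (.const 1)).eval M' = (x + 1 : ℕ) := by simp [h14]
    have hlast : ∀ M'', M''.Bounded b → AgreeOff [11, 12] M' M'' →
        ((M'' 11 0 = 0 ∧ ∀ i < x + 1, D (i + 1) * D (i + 1) ≤ 2 * D (i + 2) * D i) ∨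
        (∃ i < x + 1, M'' 11 0 = (i + 1 : ℕ) ∧ M'' 12 0 = D i ∧
          2 * D (i + 2) * D i < D (i + 1) * D (i + 1))) →
        WP C (assign 13 (cell (var 14) (var 14))) (fun M3 => M3.Bounded b ∧ M3 14 0 = (x : ℤ) ∧
          AgreeOff [11, 12, 13, 14] M (M3.write 14 0 (x + 1 : ℕ)) ∧
          (M3.write 14 0 (x + 1 : ℕ)) 13 0 = D (x + 1) ∧
          (((M3.write 14 0 (x + 1 : ℕ)) 11 0 = 0 ∧
            ∀ i < x + 1, D (i + 1) * D (i + 1) ≤ 2 * D (i + 2) * D i) ∨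
          (∃ i < x + 1, (M3.write 14 0 (x + 1 : ℕ)) 11 0 = (i + 1 : ℕ) ∧
            (M3.write 14 0 (x + 1 : ℕ)) 12 0 = D i ∧
            2 * D (i + 2) * D i < D (i + 1) * D (i + 1)))) M'' := by
      intro M'' hM'' hag hc
      have h14'' : M'' 14 0 = x := by rw [hag 14 (by decide), h14]
      refine WP.assign hM'' hC ?_
      rw [eval_cell_var (A := A) (m := m) (i := x) (c := x) (by rw [hag 4 (by decide)]; exact hA')
        (by rw [hag 5 (by decide), h5']) (by omega) (by omega) h14'' h14'', hd1]
      refine ⟨hM''.write _ _ hbd, ?_, ?_, ?_, ?_⟩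
      · rw [Memory.write_array_ne _ _ _ (by decide), h14'']
      · exact ((h.trans hag (by decide)).write (by decide) _ _).write (by decide) _ _
      · rw [Memory.write_array_ne _ _ _ (by decide), Memory.write_same]
      · simpa [Memory.write_array_ne] using hc
    have hev : (Expr.op .sub (.op .mul (cell (var 14) (var 14)) (cell (var 14) (var 14)))
        (.op .mul (.op .mul (.const 2)
          (cell (.op .add (var 14) (.const 1)) (.op .add (var 14) (.const 1))))
          (var 13))).eval M' = D (x + 1) * D (x + 1) - 2 * D (x + 2) * D x := by
      rw [eval_sub, eval_mul, eval_mul, eval_mul, eval_const, eval_var, h13,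
        eval_cell_var hA' h5' (i := x) (c := x) (by omega) (by omega) h14 h14,
        eval_cell_eq hA' h5' (i := x + 1) (c := x + 1) (by omega) (by omega) hx1 hx1, hd1, hd2]
    refine WP.seq (WP.branch hM' hC (fun hpos => ?_) fun hle => ?_)
    · rw [hev] at hpos
      have hM3 : (M'.write 11 0 (x + 1 : ℕ)).Bounded b := hM'.write _ _ (hW.index_lt (by omega))
      refine WP.seq (WP.assign hM' hC ?_)
      rw [hx1]
      refine WP.assign hM3 hC ?_
      have e : (var 13).eval (M'.write 11 0 (x + 1 : ℕ)) = D x := by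
        rw [eval_var, Memory.write_array_ne _ _ _ (by decide), h13]
      rw [e]
      refine hlast _ (hM3.write _ _ hbd0)
        (((AgreeOff.refl _ M').write (by decide) _ _).write (by decide) _ _)
        (.inr ⟨x, by omega, ?_, ?_, by linarith⟩)
      · rw [Memory.write_array_ne _ _ _ (by decide), Memory.write_same]
      · rw [Memory.write_same]
    · rw [hev] at hle
      refine WP.skip hC (hlast M' hM' (AgreeOff.refl _ _) ?_)
      rcases hcase with ⟨h11, hall⟩ | ⟨i, hi, hrest⟩
      · refine .inl ⟨h11, fun i hi => ?_⟩
        rcases (by omega : i < x ∨ i = x) with hix | rfl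
        · exact hall i hix
        · linarith
      · exact .inr ⟨i, by omega, hrest⟩
  · exact (Nat.mul_le_mul_right _ (by omega)).trans hC'
  · rintro M' hM' ⟨h, -, hcase⟩
    exact hQ M' hM' h hcase

/-- The exchange of the rows `var 7` and `var 11`, where the latter is the successor of the former,
with the recomputation of the coefficients. -/
def swapProg : Program :=
  .seq (assign 7 (.op .sub (var 11) (.const 1))) (.seq (assign 15 (cell (var 11) (var 7)))
  (.seq (assign 19 (cell (var 7) (var 7))) (.seq (assign 20 (cell (var 11) (var 11)))
  (.seq
    (forTo 9 (var 5) (.seq (assign 16 (cell (var 7) (var 9)))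
      (.seq (putCell (var 7) (var 9) (cell (var 11) (var 9)))
        (putCell (var 11) (var 9) (var 16)))))
    (forTo 14 (var 6) (.seq (assign 16 (cell (var 14) (var 7)))
      (.seq (assign 17 (cell (var 14) (var 11)))
      (.seq (putCell (var 14) (var 7)
          (.op .div (.op .add (.op .mul (var 12) (var 17)) (.op .mul (var 15) (var 16))) (var 19)))
        (putCell (var 14) (var 11)
          (.op .div (.op .sub (.op .mul (var 20) (var 16)) (.op .mul (var 15) (var 17)))
            (var 19)))))))))))

theorem wp_swapRows {k : ℕ} (hM : M.Bounded b) (hC : b + 1 ≤ C)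
    (hm : ((2 * m : ℕ) : ℤ) < 2 ^ b) (h5 : M 5 0 = (2 * m : ℕ)) (h7 : M 7 0 = k)
    (h11 : M 11 0 = (k + 1 : ℕ)) (hA : Holds m (M 4) A) (hk : k + 1 < m)
    (hC' : (2 * m + 1) * C ≤ C')
    (hQ : ∀ M', M'.Bounded b → AgreeOff [4, 9, 16] M M' →
      Holds m (M' 4) (fun i c => A (adjSwap k i) c) → Q M') :
    WP C' (forTo 9 (var 5) (.seq (assign 16 (cell (var 7) (var 9)))
      (.seq (putCell (var 7) (var 9) (cell (var 11) (var 9)))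
        (putCell (var 11) (var 9) (var 16))))) Q M := by
  refine WP.forTo (N := 2 * m) (C := C) (fun x M' => AgreeOff [4, 9, 16] M M' ∧
    Holds m (M' 4) fun i c => if c < x then A (adjSwap k i) c else A i c) hC hm hM ?_ ?_ ?_ hC' ?_
  · exact ⟨(AgreeOff.refl _ M).write (by decide) _ _, by
      simpa [Memory.write_array_ne] using hA⟩
  · rintro x M' ⟨h, -⟩
    rw [eval_var, h 5 (by decide), h5]
  · rintro x hx M' hM' h9 ⟨h, hA'⟩
    have h5' : M' 5 0 = (2 * m : ℕ) := by rw [h 5 (by decide), h5]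
    have h7' : M' 7 0 = k := by rw [h 7 (by decide), h7]
    have h11' : M' 11 0 = (k + 1 : ℕ) := by rw [h 11 (by decide), h11]
    have hbA : ∀ i < m, |A i x| < 2 ^ b := fun i hi => by
      have h1 := hA' i hi x hx
      simp only [lt_irrefl, if_false] at h1
      rw [← h1]; exact hM' _ _
    refine WP.seq (WP.assign hM' hC ?_)
    rw [eval_cell_var hA' h5' (by omega) hx h7' h9, if_neg (lt_irrefl x)]
    have hM1 : (M'.write 16 0 (A k x)).Bounded b := hM'.write _ _ (hbA k (by omega))
    refine WP.seq (wp_putCell hM1 hC (w := 2 * m) (i := k) (c := x) (x := A (k + 1) x) ?_ ?_ ?_ ?_ ?_)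
    · rw [Memory.write_array_ne _ _ _ (by decide), h5']
    · rw [eval_var, Memory.write_array_ne _ _ _ (by decide), h7']
    · rw [eval_var, Memory.write_array_ne _ _ _ (by decide), h9]
    · rw [eval_cell_var (by rw [Memory.write_array_ne _ _ _ (by decide)]; exact hA')
        (by rw [Memory.write_array_ne _ _ _ (by decide), h5']) hk hx
        (by rw [Memory.write_array_ne _ _ _ (by decide), h11'])
        (by rw [Memory.write_array_ne _ _ _ (by decide), h9]), if_neg (lt_irrefl x)]
    have hM2 := hM1.write 4 ((k : ℤ) * (2 * m : ℕ) + x) (hbA (k + 1) hk)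
    refine wp_putCell hM2 hC (w := 2 * m) (i := k + 1) (c := x) (x := A k x) ?_ ?_ ?_ ?_ ?_
    · simpa [Memory.write_array_ne] using h5'
    · simpa [Memory.write_array_ne] using h11'
    · simpa [Memory.write_array_ne] using h9
    · simp [Memory.write_array_ne, Memory.write_same]
    refine ⟨hM2.write _ _ (hbA k (by omega)), ?_, ?_, ?_⟩
    · simpa [Memory.write_array_ne] using h9
    · exact (((h.write (by decide) _ _).write (by decide) _ _).write (by decide) _ _).write
        (by decide) _ _
    · rw [Memory.write_array_ne _ _ _ (by decide), Memory.write_array_same,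
        Memory.write_array_same, Memory.write_array_ne _ _ _ (by decide)]
      refine ((hA'.update hx _).update hx _).congr fun i hi c hc => ?_
      by_cases h2 : c = x
      · subst h2
        simp only [and_true, lt_irrefl, if_false, Nat.lt_succ_self, if_true, adjSwap]
        by_cases h3 : i = k
        · simp [h3]
        · by_cases h4 : i = k + 1 <;> simp [h3, h4]
      · simp [h2, (by omega : c < x + 1 ↔ c < x)]
  · rintro M' hM' ⟨h, hA'⟩
    exact hQ M' hM' h (hA'.congr fun i hi c hc => by simp [hc])

theorem wp_swapColumns {k : ℕ} (hM : M.Bounded b) (hC : b + 1 ≤ C)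
    (hm : ((2 * m : ℕ) : ℤ) < 2 ^ b) (h5 : M 5 0 = (2 * m : ℕ)) (h6 : M 6 0 = m) (h7 : M 7 0 = k)
    (h11 : M 11 0 = (k + 1 : ℕ)) (h12 : M 12 0 = D k) (h15 : M 15 0 = A (k + 1) k)
    (h19 : M 19 0 = D (k + 1)) (h20 : M 20 0 = D (k + 2))
    (hA : Holds m (M 4) (fun i c => A (adjSwap k i) c)) (hk : k + 1 < m)
    (hb : ∀ i < m, ∀ c < 2 * m, |swapStep D A k i c| < 2 ^ b) (hC' : (2 * m + 1) * C ≤ C')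
    (hQ : ∀ M', M'.Bounded b → AgreeOff [4, 14, 16, 17] M M' →
      Holds m (M' 4) (swapStep D A k) → Q M') :
    WP C' (forTo 14 (var 6) (.seq (assign 16 (cell (var 14) (var 7)))
      (.seq (assign 17 (cell (var 14) (var 11)))
      (.seq (putCell (var 14) (var 7)
          (.op .div (.op .add (.op .mul (var 12) (var 17)) (.op .mul (var 15) (var 16))) (var 19)))
        (putCell (var 14) (var 11)
          (.op .div (.op .sub (.op .mul (var 20) (var 16)) (.op .mul (var 15) (var 17)))
            (var 19))))))) Q M := by
  refine WP.forTo (N := m) (C := C) (fun x M' => AgreeOff [4, 14, 16, 17] M M' ∧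
    Holds m (M' 4) fun i c => if i < x then swapStep D A k i c else A (adjSwap k i) c) hC
    (lt_of_le_of_lt (by exact_mod_cast (by omega)) hm) hM ?_ ?_ ?_
    ((Nat.mul_le_mul_right _ (by omega)).trans hC') ?_
  · exact ⟨(AgreeOff.refl _ M).write (by decide) _ _, by
      simpa [Memory.write_array_ne] using hA⟩
  · rintro x M' ⟨h, -⟩
    rw [eval_var, h 6 (by decide), h6]
  · rintro x hx M' hM' h14 ⟨h, hA'⟩
    have h5' : M' 5 0 = (2 * m : ℕ) := by rw [h 5 (by decide), h5]
    have h7' : M' 7 0 = k := by rw [h 7 (by decide), h7]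
    have h11' : M' 11 0 = (k + 1 : ℕ) := by rw [h 11 (by decide), h11]
    have h12' : M' 12 0 = D k := by rw [h 12 (by decide), h12]
    have h15' : M' 15 0 = A (k + 1) k := by rw [h 15 (by decide), h15]
    have h19' : M' 19 0 = D (k + 1) := by rw [h 19 (by decide), h19]
    have h20' : M' 20 0 = D (k + 2) := by rw [h 20 (by decide), h20]
    have hbA : ∀ c < 2 * m, |A (adjSwap k x) c| < 2 ^ b := fun c hc => by
      have h1 := hA' x hx c hc
      simp only [lt_irrefl, if_false] at h1
      rw [← h1]; exact hM' _ _
    refine WP.seq (WP.assign hM' hC ?_)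
    rw [eval_cell_var hA' h5' hx (c := k) (by omega) h14 h7', if_neg (lt_irrefl x)]
    set s := A (adjSwap k x) k with hs
    set t := A (adjSwap k x) (k + 1) with ht
    have hM1 : (M'.write 16 0 s).Bounded b := hM'.write _ _ (hbA k (by omega))
    refine WP.seq (WP.assign hM1 hC ?_)
    rw [eval_cell_var (by rw [Memory.write_array_ne _ _ _ (by decide)]; exact hA')
        (by rw [Memory.write_array_ne _ _ _ (by decide), h5']) hx (c := k + 1) (by omega)
        (by rw [Memory.write_array_ne _ _ _ (by decide), h14])
        (by rw [Memory.write_array_ne _ _ _ (by decide), h11']), if_neg (lt_irrefl x), ← ht]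
    have hM2 : ((M'.write 16 0 s).write 17 0 t).Bounded b := hM1.write _ _ (hbA (k + 1) (by omega))
    have hv1 : swapStep D A k x k = (D k * t + A (k + 1) k * s) / D (k + 1) := by
      simp [swapStep, hs, ht]
    have hv2 : swapStep D A k x (k + 1) = (D (k + 2) * s - A (k + 1) k * t) / D (k + 1) := by
      simp [swapStep, hs, ht]
    refine WP.seq (wp_putCell hM2 hC (w := 2 * m) (i := x) (c := k) (x := swapStep D A k x k)
      ?_ ?_ ?_ ?_ ?_)
    · simpa [Memory.write_array_ne] using h5'
    · simpa [Memory.write_array_ne] using h14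
    · simpa [Memory.write_array_ne] using h7'
    · simp [Memory.write_array_ne, Memory.write_same, hv1, h12', h15', h19']
    have hM3 := hM2.write 4 ((x : ℤ) * (2 * m : ℕ) + k) (hb x hx k (by omega))
    refine wp_putCell hM3 hC (w := 2 * m) (i := x) (c := k + 1) (x := swapStep D A k x (k + 1))
      ?_ ?_ ?_ ?_ ?_
    · simpa [Memory.write_array_ne] using h5'
    · simpa [Memory.write_array_ne] using h14
    · simpa [Memory.write_array_ne] using h11'
    · simp [Memory.write_array_ne, Memory.write_same, hv2, h20', h15', h19']
    refine ⟨hM3.write _ _ (hb x hx (k + 1) (by omega)), ?_, ?_, ?_⟩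
    · simpa [Memory.write_array_ne] using h14
    · exact ((((h.write (by decide) _ _).write (by decide) _ _).write (by decide) _ _).write
        (by decide) _ _).write (by decide) _ _
    · rw [Memory.write_array_ne _ _ _ (by decide), Memory.write_array_same,
        Memory.write_array_same, Memory.write_array_ne _ _ _ (by decide),
        Memory.write_array_ne _ _ _ (by decide)]
      refine ((hA'.update (by omega) _).update (by omega) _).congr fun i hi c hc => ?_
      by_cases h2 : i = x
      · subst h2
        simp only [true_and, lt_irrefl, if_false, Nat.lt_succ_self, if_true]
        by_cases h3 : c = k + 1
        · simp [h3]
        · by_cases h4 : c = k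
          · simp [h4]
          · simp [h3, h4, swapStep]
      · simp [h2, (by omega : i < x + 1 ↔ i < x)]
  · rintro M' hM' ⟨h, hA'⟩
    exact hQ M' hM' h (hA'.congr fun i hi c hc => by simp [hi])

theorem wp_swap {k : ℕ} (hM : M.Bounded b) (hC : b + 1 ≤ C) (hW : WordBound b m G B U)
    (h5 : M 5 0 = (2 * m : ℕ)) (h6 : M 6 0 = m)
    (h11 : M 11 0 = (k + 1 : ℕ)) (h12 : M 12 0 = D k) (hA : Holds m (M 4) A) (hk : k + 1 < m)
    (hG : Good m G B D A) (hG' : Good m G B (swapDet D A k) (swapStep D A k))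
    (hC' : (2 * m + 1) * C ≤ C')
    (hQ : ∀ M', M'.Bounded b → AgreeOff [4, 7, 9, 14, 15, 16, 17, 19, 20] M M' →
      Holds m (M' 4) (swapStep D A k) → Q M') :
    WP C' swapProg Q M := by
  have hC1 : b + 1 ≤ C' := hC.trans (by nlinarith)
  have hbA : ∀ i < m, ∀ c < 2 * m, |A i c| < 2 ^ b := fun i hi c hc =>
    hW.lt_of_le (hW.entry_le _ _ hG i hi c hc)
  have hd1 : A k k = D (k + 1) := hG.inv.diag (by omega)
  have hd2 : A (k + 1) (k + 1) = D (k + 2) := hG.inv.diag hk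
  refine WP.seq (WP.assign hM hC1 ?_)
  have e1 : (Expr.op .sub (var 11) (.const 1)).eval M = k := by simp [h11]
  rw [e1]
  have hM1 : (M.write 7 0 k).Bounded b := hM.write _ _ (hW.index_lt (by omega))
  refine WP.seq (WP.assign hM1 hC1 ?_)
  rw [eval_cell_var (A := A) (m := m) (i := k + 1) (c := k)
    (by simpa [Memory.write_array_ne] using hA) (by simpa [Memory.write_array_ne] using h5)
    hk (by omega) (by simpa [Memory.write_array_ne] using h11) (by simp [Memory.write_same])]
  have hM2 := hM1.write 15 0 (hbA (k + 1) hk k (by omega))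
  refine WP.seq (WP.assign hM2 hC1 ?_)
  rw [eval_cell_var (A := A) (m := m) (i := k) (c := k)
    (by simpa [Memory.write_array_ne] using hA) (by simpa [Memory.write_array_ne] using h5)
    (by omega) (by omega) (by simp [Memory.write_array_ne, Memory.write_same])
    (by simp [Memory.write_array_ne, Memory.write_same])]
  have hM3 := hM2.write 19 0 (hbA k (by omega) k (by omega))
  refine WP.seq (WP.assign hM3 hC1 ?_)
  rw [eval_cell_var (A := A) (m := m) (i := k + 1) (c := k + 1)
    (by simpa [Memory.write_array_ne] using hA) (by simpa [Memory.write_array_ne] using h5)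
    hk (by omega) (by simpa [Memory.write_array_ne] using h11)
    (by simpa [Memory.write_array_ne] using h11)]
  have hM4 := hM3.write 20 0 (hbA (k + 1) hk (k + 1) (by omega))
  have hag4 : AgreeOff [4, 7, 9, 14, 15, 16, 17, 19, 20] M
      ((((M.write 7 0 k).write 15 0 (A (k + 1) k)).write 19 0 (A k k)).write 20 0
        (A (k + 1) (k + 1))) :=
    ((((AgreeOff.refl _ M).write (by decide) _ _).write (by decide) _ _).write
      (by decide) _ _).write (by decide) _ _
  refine WP.seq (wp_swapRows (A := A) (k := k) hM4 hC hW.width ?_ ?_ ?_ ?_ hk hC' ?_)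
  · simpa [Memory.write_array_ne] using h5
  · simp [Memory.write_array_ne, Memory.write_same]
  · simpa [Memory.write_array_ne] using h11
  · simpa [Memory.write_array_ne] using hA
  intro M5 hM5 hag5 hA5
  refine wp_swapColumns (D := D) (A := A) (k := k) hM5 hC hW.width ?_ ?_ ?_ ?_ ?_ ?_ ?_ ?_ hA5 hk
    (fun i hi c hc => hW.lt_of_le (hW.entry_le _ _ hG' i hi c hc)) hC' ?_
  · rw [hag5 5 (by decide)]; simpa [Memory.write_array_ne] using h5
  · rw [hag5 6 (by decide)]; simpa [Memory.write_array_ne] using h6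
  · rw [hag5 7 (by decide)]; simp [Memory.write_array_ne, Memory.write_same]
  · rw [hag5 11 (by decide)]; simpa [Memory.write_array_ne] using h11
  · rw [hag5 12 (by decide)]; simpa [Memory.write_array_ne] using h12
  · rw [hag5 15 (by decide)]; simp [Memory.write_array_ne, Memory.write_same]
  · rw [hag5 19 (by decide)]; simp [Memory.write_array_ne, Memory.write_same, hd1]
  · rw [hag5 20 (by decide)]; simp [Memory.write_same, hd2]
  intro M6 hM6 hag6 hA6
  exact hQ M6 hM6 ((hag4.trans hag5 (by decide)).trans hag6 (by decide)) hA6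

theorem Good.swap {k : ℕ} (hG : Good m G B D A) (hk : k + 1 < m) (hr : SizeReduced D A (k + 1))
    (hs : 2 * D (k + 2) * D k < D (k + 1) * D (k + 1)) :
    Good m G B (swapDet D A k) (swapStep D A k) := by
  refine ⟨hG.inv.swap hk, fun j hj => ?_, fun i hi => ?_⟩
  · by_cases hjk : j = k + 1
    · subst hjk
      have h1 := hG.inv.swapDet_le hk hr hs
      have h2 : 0 < D (k + 1) := by exact_mod_cast hG.inv.tri.pos (k + 1) hj
      have h3 := hG.det_le _ hj
      omega
    · simp only [swapDet, if_neg hjk]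
      exact hG.det_le j hj
  · rw [normSq_swapStep hk]
    exact hG.norm_le _ (adjSwap_lt hk hi)

/-- The lattice reduction. -/
def reduceProg : Program :=
  .seq (assign 11 (.const 1)) (.loop (var 11)
    (.seq reduceAllProg (.seq searchProg (.branch (var 11) swapProg .skip))))

theorem wp_reduce {n : ℕ} (hm : m = n + 1) (hM : M.Bounded b) (hC : b + 1 ≤ C)
    (hW : WordBound b m G B U) (h0 : M 0 0 = n) (h5 : M 5 0 = (2 * m : ℕ)) (h6 : M 6 0 = m)
    (hA : Holds m (M 4) A) (hG : Good m G B D A) {s : ℕ} (hs : 3 ^ s * potential m D < 4 ^ s)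
    (hC' : (s + 1) * ((2 * m + 1) ^ 3 * C) ≤ C')
    (hQ : ∀ M' D' A', M'.Bounded b → M' 0 0 = (n : ℤ) →
      M' 5 0 = ((2 * m : ℕ) : ℤ) → M' 6 0 = (m : ℤ) → Holds m (M' 4) A' →
      Good m G B D' A' → D' m = D m →
      (∀ i < n, D' (i + 1) * D' (i + 1) ≤ 2 * D' (i + 2) * D' i) → Q M') :
    WP C' reduceProg Q M := by
  have hb0 : (1 : ℤ) < 2 ^ b :=
    lt_of_le_of_lt (by exact_mod_cast (by omega : 1 ≤ 2 * m)) hW.width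
  have hCm : (2 * m + 1) * C ≤ (2 * m + 1) ^ 3 * C :=
    Nat.mul_le_mul_right _ (Nat.le_self_pow (by norm_num) _)
  have hC3 : b + 1 ≤ (2 * m + 1) ^ 3 * C := by nlinarith
  have hC3' : (2 * m + 1) ^ 3 * C ≤ C' := by nlinarith
  have hM1 : (M.write 11 0 1).Bounded b := hM.write _ _ (by simpa using hb0)
  refine WP.seq (WP.assign hM (hC3.trans hC3') ?_)
  refine WP.loop (fun s M' => M'.Bounded b ∧ M' 0 0 = (n : ℤ) ∧
    M' 5 0 = ((2 * m : ℕ) : ℤ) ∧ M' 6 0 = (m : ℤ) ∧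
    ∃ D' A', Holds m (M' 4) A' ∧ Good m G B D' A' ∧ D' m = D m ∧
      (0 < M' 11 0 → 3 ^ s * potential m D' < 4 ^ s) ∧
      (M' 11 0 ≤ 0 → ∀ i < n, D' (i + 1) * D' (i + 1) ≤ 2 * D' (i + 2) * D' i)) hC3
    (fun _ _ h => h.1) ?_ (s := s) ⟨hM1, ?_, ?_, ?_, D, A, ?_, hG, rfl, fun _ => hs, ?_⟩ hC' ?_
  · rintro s M' ⟨hM', h0', h5', h6', D', A', hA', hG', hDm, hpot, -⟩ hpos
    have hpot := hpot hpos
    have hpp := hG'.inv.potential_pos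
    obtain _ | s := s
    · simp at hpot; omega
    refine ⟨s, rfl, WP.seq (wp_reduceAll hM' hC hW h5' h6' hA' hG' le_rfl ?_)⟩
    intro M2 A2 hM2 hag2 hA2 hG2 hred
    have h02 : M2 0 0 = n := by rw [hag2 0 (by decide), h0']
    have h52 : M2 5 0 = (2 * m : ℕ) := by rw [hag2 5 (by decide), h5']
    have h62 : M2 6 0 = m := by rw [hag2 6 (by decide), h6']
    refine WP.seq (wp_search hm hM2 hC hW h02 h52 hA2 hG2 hCm ?_)
    intro M3 hM3 hag3 hcase
    have h03 : M3 0 0 = n := by rw [hag3 0 (by decide), h02]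
    have h53 : M3 5 0 = (2 * m : ℕ) := by rw [hag3 5 (by decide), h52]
    have h63 : M3 6 0 = m := by rw [hag3 6 (by decide), h62]
    have hA3 : Holds m (M3 4) A2 := by rw [hag3 4 (by decide)]; exact hA2
    rcases hcase with ⟨h11, hall⟩ | ⟨k, hk, h11, h12, hviol⟩
    · refine WP.branch hM3 hC3 (fun h => ?_) fun _ => WP.skip hC3
        ⟨hM3, h03, h53, h63, D', A2, hA3, hG2, hDm, fun h => ?_, fun _ => hall⟩
      · rw [eval_var, h11] at h; omega
      · rw [h11] at h; omega
    · have hkm : k + 1 < m := by omega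
      have hGs := hG2.swap hkm (hred _ hkm) hviol
      refine WP.branch hM3 hC3 (fun _ => ?_) fun h => ?_
      · refine wp_swap hM3 hC hW h53 h63 h11 h12 hA3 hkm hG2 hGs hCm ?_
        intro M4 hM4 hag4 hA4
        refine ⟨hM4, ?_, ?_, ?_, _, _, hA4, hGs, ?_, fun _ => ?_, fun h => ?_⟩
        · rw [hag4 0 (by decide), h03]
        · rw [hag4 5 (by decide), h53]
        · rw [hag4 6 (by decide), h63]
        · simp [swapDet, hkm.ne', hDm]
        · have h1 := hG2.inv.potential_swap hkm (hred _ hkm) hviol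
          rw [pow_succ, pow_succ] at hpot
          have h2 : (0 : ℤ) < 3 ^ s := by positivity
          nlinarith
        · rw [hag4 11 (by decide), h11] at h; omega
      · rw [eval_var, h11] at h; omega
  · rw [Memory.write_array_ne _ _ _ (by decide), h0]
  · rw [Memory.write_array_ne _ _ _ (by decide), h5]
  · rw [Memory.write_array_ne _ _ _ (by decide), h6]
  · rw [Memory.write_array_ne _ _ _ (by decide)]; exact hA
  · intro h; rw [eval_const, Memory.write_same] at h; omega
  · rintro s M' ⟨hM', h0', h5', h6', D', A', hA', hG', hDm, -, hall⟩ hle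
    exact hQ M' D' A' hM' h0' h5' h6' hA' hG' hDm (hall hle)

end

section

variable {b C C' n : ℕ} {Q : Memory → Prop} {M : Memory}

/-- The product of the denominators, and a power of two with triangular exponent. -/
def productsProg : Program :=
  .seq (assign 21 (.const 1)) (.seq (assign 22 (.const 1)) (.seq (assign 23 (.const 1))
    (forTo 8 (var 0) (.seq (assign 21 (.op .mul (var 21) (.read 2 (.op .add (var 8) (.const 1)))))
      (.seq (assign 22 (.op .mul (var 22) (.const 2)))
        (assign 23 (.op .mul (var 23) (var 22))))))))

theorem wp_products {v : ℕ → ℤ} (hM : M.Bounded b) (hC : b + 1 ≤ C) (h0 : M 0 0 = n)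
    (hv : ∀ i < n, M 2 ((i : ℤ) + 1) = v i) (hn : (n : ℤ) < 2 ^ b)
    (h1 : ∀ x ≤ n, |∏ i ∈ range x, v i| < 2 ^ b) (h2 : ∀ x ≤ n, (2 : ℤ) ^ x < 2 ^ b)
    (h3 : ∀ x ≤ n, (2 : ℤ) ^ (∑ i ∈ range (x + 1), i) < 2 ^ b) (hC' : (n + 1) * C ≤ C')
    (hQ : ∀ M', M'.Bounded b → AgreeOff [8, 21, 22, 23] M M' → M' 21 0 = ∏ i ∈ range n, v i →
      M' 23 0 = 2 ^ (∑ i ∈ range (n + 1), i) → Q M') : WP C' productsProg Q M := by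
  have hCC : C ≤ C' := by nlinarith
  have hb1 : |(1 : ℤ)| < 2 ^ b := by simpa using h2 0 (Nat.zero_le _)
  have hM1 : (M.write 21 0 1).Bounded b := hM.write _ _ hb1
  have hM2 : ((M.write 21 0 1).write 22 0 1).Bounded b := hM1.write _ _ hb1
  have hM3 : (((M.write 21 0 1).write 22 0 1).write 23 0 1).Bounded b := hM2.write _ _ hb1
  refine WP.seq (WP.assign hM (hC.trans hCC) ?_)
  refine WP.seq (WP.assign hM1 (hC.trans hCC) ?_)
  refine WP.seq (WP.assign hM2 (hC.trans hCC) ?_)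
  refine WP.forTo (N := n) (C := C) (fun x M' => AgreeOff [8, 21, 22, 23] M M' ∧
    M' 21 0 = ∏ i ∈ range x, v i ∧ M' 22 0 = 2 ^ x ∧ M' 23 0 = 2 ^ (∑ i ∈ range (x + 1), i))
    hC hn hM3 ?_ ?_ ?_ hC' ?_
  · exact ⟨((((AgreeOff.refl _ M).write (by decide) _ _).write (by decide) _ _).write
      (by decide) _ _).write (by decide) _ _, by simp [Memory.write_array_ne, Memory.write_same],
      by simp [Memory.write_array_ne, Memory.write_same],
      by simp [Memory.write_array_ne, Memory.write_same]⟩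
  · rintro x M' ⟨h, -⟩
    rw [eval_var, h 0 (by decide), h0]
  · rintro x hx M' hM' h8 ⟨h, h21, h22, h23⟩
    have e1 : (Expr.op .mul (var 21) (.read 2 (.op .add (var 8) (.const 1)))).eval M' =
        ∏ i ∈ range (x + 1), v i := by
      simp only [eval_mul, eval_var, eval_read, eval_add, eval_const, h21, h8, prod_range_succ]
      rw [h 2 (by decide), hv x hx]
    refine WP.seq (WP.assign hM' hC ?_)
    rw [e1]
    have hM4 := hM'.write 21 0 (h1 (x + 1) hx)
    refine WP.seq (WP.assign hM4 hC ?_)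
    have e2 : (Expr.op .mul (var 22) (.const 2)).eval (M'.write 21 0 (∏ i ∈ range (x + 1), v i)) =
        2 ^ (x + 1) := by
      simp [Memory.write_array_ne, h22, pow_succ]
    rw [e2]
    have hM5 := hM4.write 22 0 (x := 2 ^ (x + 1)) (by
      rw [abs_of_pos (by positivity)]; exact h2 (x + 1) hx)
    refine WP.assign hM5 hC ?_
    have e3 : (Expr.op .mul (var 23) (var 22)).eval
        ((M'.write 21 0 (∏ i ∈ range (x + 1), v i)).write 22 0 (2 ^ (x + 1))) =
        2 ^ (∑ i ∈ range (x + 1 + 1), i) := by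
      rw [sum_range_succ _ (x + 1), pow_add]
      simp [Memory.write_array_ne, Memory.write_same, h23]
      ring
    rw [e3]
    refine ⟨hM5.write _ _ (by rw [abs_of_pos (by positivity)]; exact h3 (x + 1) hx), ?_, ?_, ?_, ?_,
      ?_⟩
    · simpa [Memory.write_array_ne] using h8
    · exact (((h.write (by decide) _ _).write (by decide) _ _).write (by decide) _ _).write
        (by decide) _ _
    all_goals simp [Memory.write_array_ne, Memory.write_same]
  · rintro M' hM' ⟨h, h21, h22, h23⟩
    exact hQ M' hM' h h21 h23

/-- The weights of the two parts of the form. -/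
def weightsProg : Program :=
  .seq (assign 24 (.op .mul (var 21) (var 21))) (forTo 8 (var 6)
    (.seq (assign 23 (.op .mul (var 23) (.op .mul (var 2) (var 2))))
      (assign 24 (.op .mul (var 24) (.op .mul (var 1) (var 1))))))

theorem wp_weights {m : ℕ} {V e f p : ℤ} (hM : M.Bounded b) (hC : b + 1 ≤ C) (h6 : M 6 0 = m)
    (h1 : M 1 0 = e) (h2 : M 2 0 = f) (h21 : M 21 0 = V) (h23 : M 23 0 = p)
    (hm : (m : ℤ) < 2 ^ b) (hb1 : ∀ x ≤ m, |f ^ (2 * x) * p| < 2 ^ b)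
    (hb2 : ∀ x ≤ m, |V ^ 2 * e ^ (2 * x)| < 2 ^ b) (hC' : (m + 1) * C ≤ C')
    (hQ : ∀ M', M'.Bounded b → AgreeOff [8, 23, 24] M M' → M' 23 0 = f ^ (2 * m) * p →
      M' 24 0 = V ^ 2 * e ^ (2 * m) → Q M') : WP C' weightsProg Q M := by
  have hCC : C ≤ C' := by nlinarith
  refine WP.seq (WP.assign hM (hC.trans hCC) ?_)
  have e1 : (Expr.op .mul (var 21) (var 21)).eval M = V ^ 2 := by simp [h21, sq]
  rw [e1]
  have hM1 := hM.write 24 0 (x := V ^ 2) (by simpa using hb2 0 (Nat.zero_le _))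
  refine WP.forTo (N := m) (C := C) (fun x M' => AgreeOff [8, 23, 24] M M' ∧
    M' 23 0 = f ^ (2 * x) * p ∧ M' 24 0 = V ^ 2 * e ^ (2 * x)) hC hm hM1 ?_ ?_ ?_ hC' ?_
  · exact ⟨((AgreeOff.refl _ M).write (by decide) _ _).write (by decide) _ _,
      by simp [Memory.write_array_ne, h23],
      by simp [Memory.write_array_ne, Memory.write_same]⟩
  · rintro x M' ⟨h, -⟩
    rw [eval_var, h 6 (by decide), h6]
  · rintro x hx M' hM' h8 ⟨h, h23', h24'⟩
    have h1' : M' 1 0 = e := by rw [h 1 (by decide), h1]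
    have h2' : M' 2 0 = f := by rw [h 2 (by decide), h2]
    have e2 : (Expr.op .mul (var 23) (.op .mul (var 2) (var 2))).eval M' =
        f ^ (2 * (x + 1)) * p := by
      simp only [eval_mul, eval_var, h23', h2']; ring
    refine WP.seq (WP.assign hM' hC ?_)
    rw [e2]
    have hM2 := hM'.write 23 0 (hb1 (x + 1) hx)
    have e3 : (Expr.op .mul (var 24) (.op .mul (var 1) (var 1))).eval
        (M'.write 23 0 (f ^ (2 * (x + 1)) * p)) = V ^ 2 * e ^ (2 * (x + 1)) := by
      simp only [eval_mul, eval_var, Memory.write_array_ne _ _ _ (by decide : (24 : ℕ) ≠ 23),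
        Memory.write_array_ne _ _ _ (by decide : (1 : ℕ) ≠ 23), h24', h1']
      ring
    refine WP.assign hM2 hC ?_
    rw [e3]
    refine ⟨hM2.write _ _ (hb2 (x + 1) hx), ?_, ?_, ?_, ?_⟩
    · simpa [Memory.write_array_ne] using h8
    · exact ((h.write (by decide) _ _).write (by decide) _ _).write (by decide) _ _
    all_goals simp [Memory.write_array_ne, Memory.write_same]
  · rintro M' hM' ⟨h, h23', h24'⟩
    exact hQ M' hM' h h23' h24'

/-- The initial matrix. -/
def fillProg : Program :=
  .seq (assign 25 (.const 1)) (.seq (forTo 8 (var 0)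
    (.seq (putCell (var 8) (var 8) (.op .mul (.op .mul (var 25) (.op .mul (var 23) (var 21))) (var 21)))
    (.seq (putCell (var 0) (var 8) (.op .mul (.op .mul (var 25) (.op .mul (var 23) (var 21)))
      (.op .sub (.const 0) (.op .mul (.op .div (var 21) (.read 2 (.op .add (var 8) (.const 1))))
        (.read 1 (.op .add (var 8) (.const 1)))))))
    (.seq (putCell (var 8) (.op .add (var 6) (var 8)) (.const 1))
      (assign 25 (.op .mul (var 25) (.op .mul (var 23) (.op .mul (var 21) (var 21)))))))))
  (.seq (putCell (var 0) (var 0) (.op .mul (var 25) (var 24)))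
    (putCell (var 0) (.op .add (var 6) (var 0)) (.const 1))))

theorem wp_fill {κ V E : ℤ} {u v : ℕ → ℤ} (hM : M.Bounded b) (hC : b + 1 ≤ C) (h0 : M 0 0 = n)
    (h4 : M 4 = fun _ => 0) (h5 : M 5 0 = (2 * (n + 1) : ℕ)) (h6 : M 6 0 = (n + 1 : ℕ))
    (hu : ∀ i < n, M 1 ((i : ℤ) + 1) = u i) (hv : ∀ i < n, M 2 ((i : ℤ) + 1) = v i)
    (h21 : M 21 0 = V) (h23 : M 23 0 = κ) (h24 : M 24 0 = E)
    (hb0 : (1 : ℤ) < 2 ^ b) (hn : (n : ℤ) < 2 ^ b) (hb1 : ∀ x ≤ n, |(κ * V ^ 2) ^ x| < 2 ^ b)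
    (hb2 : ∀ i < n + 1, ∀ c < 2 * (n + 1),
      |initMatrix n κ V E (fun i => V / v i * u i) i c| < 2 ^ b)
    (hC' : (n + 1) * C ≤ C')
    (hQ : ∀ M', M'.Bounded b → AgreeOff [4, 8, 25] M M' →
      Holds (n + 1) (M' 4) (initMatrix n κ V E fun i => V / v i * u i) → Q M') :
    WP C' fillProg Q M := by
  have hCC : C ≤ C' := by nlinarith
  set A := initMatrix n κ V E (fun i => V / v i * u i) with hA
  have hdiag : ∀ x < n, A x x = (κ * V ^ 2) ^ x * (κ * V) * V := fun x hx => by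
    simp [hA, initMatrix, hx, hx.ne]
  have hlast : ∀ x < n, A n x = (κ * V ^ 2) ^ x * (κ * V) * (0 - V / v x * u x) := fun x hx => by
    simp [hA, initMatrix, hx, hx.ne]
  have hcol : ∀ x < n, ∀ i, i ≠ x → i ≠ n → A i x = 0 := fun x hx i h1 h2 => by
    simp [hA, initMatrix, hx, h1.symm, h2]
  have hone : ∀ x ≤ n, ∀ i, A i (n + 1 + x) = if i = x then 1 else 0 := fun x hx i => by
    have n1 : ¬ n + 1 + x < n := by omega
    have n2 : ¬ n + 1 + x = n := by omega
    simp only [hA, initMatrix, if_neg n1, if_neg n2, Nat.add_left_cancel_iff, eq_comm (a := x)]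
  have hcorner : ∀ i, A i n = if i = n then (κ * V ^ 2) ^ n * E else 0 := fun i => by
    simp [hA, initMatrix]
  have hb0' : |(1 : ℤ)| < 2 ^ b := by simpa using hb0
  refine WP.seq (WP.assign hM (hC.trans hCC) ?_)
  have hM1 : (M.write 25 0 1).Bounded b := hM.write _ _ hb0'
  refine WP.seq (WP.forTo (N := n) (C := C) (fun x M' => AgreeOff [4, 8, 25] M M' ∧
    M' 25 0 = (κ * V ^ 2) ^ x ∧ Holds (n + 1) (M' 4) fun i c =>
      if c < x ∨ n + 1 ≤ c ∧ c < n + 1 + x then A i c else 0) hC hn hM1 ?_ ?_ ?_ hC' ?_)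
  · refine ⟨((AgreeOff.refl _ M).write (by decide) _ _).write (by decide) _ _,
      by simp [Memory.write_array_ne, Memory.write_same], fun i hi c hc => ?_⟩
    simp [Memory.write_array_ne, h4]
  · rintro x M' ⟨h, -⟩
    rw [eval_var, h 0 (by decide), h0]
  · rintro x hx M' hM' h8 ⟨h, h25, hA'⟩
    have h0' : M' 0 0 = n := by rw [h 0 (by decide), h0]
    have h5' : M' 5 0 = (2 * (n + 1) : ℕ) := by rw [h 5 (by decide), h5]
    have h6' : M' 6 0 = (n + 1 : ℕ) := by rw [h 6 (by decide), h6]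
    have h21' : M' 21 0 = V := by rw [h 21 (by decide), h21]
    have h23' : M' 23 0 = κ := by rw [h 23 (by decide), h23]
    have hu' : M' 1 ((x : ℤ) + 1) = u x := by rw [h 1 (by decide), hu x hx]
    have hv' : M' 2 ((x : ℤ) + 1) = v x := by rw [h 2 (by decide), hv x hx]
    refine WP.seq (wp_putCell hM' hC (i := x) (c := x) (x := A x x) h5' h8 h8 ?_ ?_)
    · simp [h25, h21', h23', hdiag x hx]
    have hM2 := hM'.write 4 ((x : ℤ) * (2 * (n + 1) : ℕ) + x) (hb2 x (by omega) x (by omega))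
    refine WP.seq (wp_putCell hM2 hC (w := 2 * (n + 1)) (i := n) (c := x) (x := A n x)
      ?_ ?_ ?_ ?_ ?_)
    · simpa [Memory.write_array_ne] using h5'
    · simpa [Memory.write_array_ne] using h0'
    · simpa [Memory.write_array_ne] using h8
    · rw [hlast x hx]
      simp [Memory.write_array_ne, h25, h21', h23', h8, hu', hv']
    have hM3 := hM2.write 4 ((n : ℤ) * (2 * (n + 1) : ℕ) + x) (hb2 n (by omega) x (by omega))
    refine WP.seq (wp_putCell hM3 hC (w := 2 * (n + 1)) (i := x) (c := n + 1 + x) (x := 1)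
      ?_ ?_ ?_ rfl ?_)
    · simpa [Memory.write_array_ne] using h5'
    · simpa [Memory.write_array_ne] using h8
    · simp [Memory.write_array_ne, h8, h6']
    have hM4 := hM3.write 4 ((x : ℤ) * (2 * (n + 1) : ℕ) + (n + 1 + x : ℕ)) hb0'
    refine WP.assign hM4 hC ?_
    have e1 : (Expr.op .mul (var 25) (.op .mul (var 23) (.op .mul (var 21) (var 21)))).eval
        (((M'.write 4 ((x : ℤ) * (2 * (n + 1) : ℕ) + x) (A x x)).write 4
          ((n : ℤ) * (2 * (n + 1) : ℕ) + x) (A n x)).write 4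
          ((x : ℤ) * (2 * (n + 1) : ℕ) + (n + 1 + x : ℕ)) 1) = (κ * V ^ 2) ^ (x + 1) := by
      simp only [eval_mul, eval_var, Memory.write_array_ne _ _ _ (by decide : (25 : ℕ) ≠ 4),
        Memory.write_array_ne _ _ _ (by decide : (23 : ℕ) ≠ 4),
        Memory.write_array_ne _ _ _ (by decide : (21 : ℕ) ≠ 4), h25, h23', h21']
      ring
    rw [e1]
    refine ⟨hM4.write _ _ (hb1 (x + 1) hx), ?_, ?_, ?_, ?_⟩
    · simpa [Memory.write_array_ne] using h8
    · exact ((((h.write (by decide) _ _).write (by decide) _ _).write (by decide) _ _).write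
        (by decide) _ _).write (by decide) _ _
    · simp [Memory.write_array_ne, Memory.write_same]
    · rw [Memory.write_array_ne _ _ _ (by decide), Memory.write_array_ne _ _ _ (by decide),
        Memory.write_array_same, Memory.write_array_same, Memory.write_array_same]
      refine (((hA'.update (by omega) _).update (by omega) _).update (by omega) _).congr
        fun i hi c hc => ?_
      rcases (by omega : c = x ∨ c = n + 1 + x ∨ (c ≠ x ∧ c ≠ n + 1 + x)) with rfl | rfl | ⟨h1, h2⟩
      · have n1 : c ≠ n + 1 + c := by omega
        by_cases hin : i = n
        · simp [hin]
        · by_cases hic : i = c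
          · simp [hic, hx.ne]
          · simp [hin, hic, hcol c hx i hic hin]
      · have n1 : ¬ n + 1 + x = x := by omega
        rw [hone x hx.le i]
        by_cases hix : i = x
        · simp [hix]
        · simp [hix]
      · have n1 : (c < x + 1 ∨ n + 1 ≤ c ∧ c < n + 1 + (x + 1)) ↔
            (c < x ∨ n + 1 ≤ c ∧ c < n + 1 + x) := by omega
        simp only [h1, h2, and_false, if_false, n1]
  · rintro M' hM' ⟨h, h25, hA'⟩
    have h0' : M' 0 0 = n := by rw [h 0 (by decide), h0]
    have h5' : M' 5 0 = (2 * (n + 1) : ℕ) := by rw [h 5 (by decide), h5]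
    have h6' : M' 6 0 = (n + 1 : ℕ) := by rw [h 6 (by decide), h6]
    have h24' : M' 24 0 = E := by rw [h 24 (by decide), h24]
    refine WP.seq (wp_putCell hM' (hC.trans hCC) (i := n) (c := n) (x := A n n) h5' h0' h0' ?_ ?_)
    · simp [h25, h24', hcorner]
    have hM2 := hM'.write 4 ((n : ℤ) * (2 * (n + 1) : ℕ) + n) (hb2 n (by omega) n (by omega))
    refine wp_putCell hM2 (hC.trans hCC) (w := 2 * (n + 1)) (i := n) (c := n + 1 + n) (x := 1)
      ?_ ?_ ?_ rfl ?_
    · simpa [Memory.write_array_ne] using h5'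
    · simpa [Memory.write_array_ne] using h0'
    · simp [Memory.write_array_ne, h0', h6']
    refine hQ _ (hM2.write _ _ hb0') ((h.write (by decide) _ _).write (by decide) _ _) ?_
    rw [Memory.write_array_same, Memory.write_array_same]
    refine ((hA'.update (by omega) _).update (by omega) _).congr fun i hi c hc => ?_
    rcases (by omega : c = n ∨ c = n + 1 + n ∨ (c ≠ n ∧ c ≠ n + 1 + n)) with rfl | rfl | ⟨h1, h2⟩
    · have n1 : ¬ c = c + 1 + c := by omega
      by_cases hin : i = c
      · simp [hin]
      · simp [hin, hcorner]
    · rw [hone n le_rfl i]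
      by_cases hix : i = n
      · simp [hix]
      · simp [hix]
    · have n1 : c < n ∨ n + 1 ≤ c ∧ c < n + 1 + n := by omega
      simp only [h1, h2, and_false, if_false, if_pos n1]

/-- The first vector, with the sign that makes its last coordinate non-negative. -/
def outputProg : Program :=
  .seq (.branch (cell (.const 0) (.op .add (var 6) (var 0))) (assign 27 (.const 1))
      (assign 27 (.const (-1))))
    (.seq (forTo 8 (var 0) (.write 3 (.op .add (var 8) (.const 1))
        (.op .mul (var 27) (cell (.const 0) (.op .add (var 6) (var 8))))))
      (assign 3 (.op .mul (var 27) (cell (.const 0) (.op .add (var 6) (var 0))))))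

theorem wp_output {A : ℕ → ℕ → ℤ} (hM : M.Bounded b) (hC : b + 1 ≤ C) (h0 : M 0 0 = n)
    (h5 : M 5 0 = (2 * (n + 1) : ℕ)) (h6 : M 6 0 = (n + 1 : ℕ)) (hA : Holds (n + 1) (M 4) A)
    (hb0 : (1 : ℤ) < 2 ^ b) (hn : (n : ℤ) < 2 ^ b) (hC' : (n + 1) * C ≤ C')
    (hQ : ∀ M', ∀ s : ℤ, (s = 1 ∧ 0 < A 0 (n + 1 + n) ∨ s = -1 ∧ A 0 (n + 1 + n) ≤ 0) →
      M' 3 0 = s * A 0 (n + 1 + n) → (∀ i < n, M' 3 ((i : ℤ) + 1) = s * A 0 (n + 1 + i)) → Q M') :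
    WP C' outputProg Q M := by
  have hCC : C ≤ C' := by nlinarith
  have hcell : ∀ M', AgreeOff [3, 8, 27] M M' → ∀ x ≤ n, ∀ k, M' k 0 = (x : ℤ) →
      (cell (.const 0) (.op .add (var 6) (var k))).eval M' = A 0 (n + 1 + x) := by
    intro M' h x hx k hk
    refine eval_cell_eq (by rw [h 4 (by decide)]; exact hA) (by rw [h 5 (by decide), h5])
      (by omega) (by omega) (by simp) ?_
    rw [eval_add, eval_var, eval_var, h 6 (by decide), h6, hk]
    push_cast; rfl
  have hbA : ∀ c < 2 * (n + 1), |A 0 c| < 2 ^ b := fun c hc => by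
    rw [← hA 0 (by omega) c hc]; exact hM _ _
  have main : ∀ s : ℤ, |s| = 1 →
      (s = 1 ∧ 0 < A 0 (n + 1 + n) ∨ s = -1 ∧ A 0 (n + 1 + n) ≤ 0) →
      WP C' (.seq (forTo 8 (var 0) (.write 3 (.op .add (var 8) (.const 1))
        (.op .mul (var 27) (cell (.const 0) (.op .add (var 6) (var 8))))))
      (assign 3 (.op .mul (var 27) (cell (.const 0) (.op .add (var 6) (var 0)))))) Q
      (M.write 27 0 s) := by
    intro s hs hcase
    have hbs : ∀ c < 2 * (n + 1), |s * A 0 c| < 2 ^ b := fun c hc => by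
      rw [abs_mul, hs, one_mul]; exact hbA c hc
    refine WP.seq (WP.forTo (N := n) (C := C) (fun x M' => AgreeOff [3, 8, 27] M M' ∧
      M' 27 0 = s ∧ ∀ i < x, M' 3 ((i : ℤ) + 1) = s * A 0 (n + 1 + i)) hC hn
      (hM.write _ _ (by rw [hs]; exact hb0)) ?_ ?_ ?_ hC' ?_)
    · exact ⟨((AgreeOff.refl _ M).write (by decide) _ _).write (by decide) _ _,
        by simp [Memory.write_array_ne, Memory.write_same], fun i hi => by omega⟩
    · rintro x M' ⟨h, -⟩
      rw [eval_var, h 0 (by decide), h0]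
    · rintro x hx M' hM' h8 ⟨h, h27, h3⟩
      refine WP.write hM' hC ?_
      rw [eval_mul, hcell M' h x hx.le 8 h8, eval_var, h27, eval_add, eval_var, eval_const, h8]
      refine ⟨hM'.write _ _ (hbs _ (by omega)), ?_, ?_, ?_, fun i hi => ?_⟩
      · simpa [Memory.write_array_ne] using h8
      · exact (h.write (by decide) _ _).write (by decide) _ _
      · simpa [Memory.write_array_ne] using h27
      · rw [Memory.write_array_ne _ _ _ (by decide)]
        rcases (by omega : i < x ∨ i = x) with hix | rfl
        · rw [Memory.write_cell_ne _ _ (by omega), h3 i hix]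
        · rw [Memory.write_same]
    · rintro M' hM' ⟨h, h27, h3⟩
      refine WP.assign hM' (hC.trans hCC) ?_
      rw [eval_mul, hcell M' h n le_rfl 0 (by rw [h 0 (by decide), h0]), eval_var, h27]
      refine hQ _ s hcase (by rw [Memory.write_same]) fun i hi => ?_
      rw [Memory.write_cell_ne _ _ (by omega), h3 i hi]
  refine WP.seq (WP.branch hM (hC.trans hCC) (fun hpos => ?_) fun hle => ?_)
  · rw [hcell M (AgreeOff.refl _ _) n le_rfl 0 h0] at hpos
    exact WP.assign hM (hC.trans hCC) (main 1 (by simp) (.inl ⟨rfl, hpos⟩))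
  · rw [hcell M (AgreeOff.refl _ _) n le_rfl 0 h0] at hle
    exact WP.assign hM (hC.trans hCC) (main (-1) (by simp) (.inr ⟨rfl, hle⟩))

end
end LatticeReduction

namespace SimultaneousApproximation

open RAM LatticeReduction Finset

/-- The number of digits of the parameters of the form, for inputs of size `σ`. -/
def paramLength (σ : ℕ) : ℕ := 4 * σ ^ 2 + 1

/-- The word length that suffices for inputs of size `σ`. -/
def wordLength (σ : ℕ) : ℕ := (5 * paramLength σ * σ + 1) * (σ + 1) + 1

/-- The number of exchanges that suffices for inputs of size `σ`. -/
def swapBound (σ : ℕ) : ℕ := 3 * (3 * paramLength σ * σ ^ 2) + 1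

/-- A bound for the cost per unit of weight for inputs of size `σ`. -/
def costBound (σ : ℕ) : ℕ := (swapBound σ + 1) * ((2 * σ + 1) ^ 3 * (wordLength σ + 1))

/-- The algorithm. -/
def approxProg : Program :=
  .seq (assign 6 (.op .add (var 0) (.const 1))) (.seq (assign 5 (.op .mul (.const 2) (var 6)))
    (.seq productsProg (.seq weightsProg (.seq fillProg (.seq reduceProg outputProg)))))

section

variable {n : ℕ} {a : Fin n → ℚ} {ε : ℚ}

theorem inputMemory_zero : inputMemory a ε 0 0 = n := by simp [inputMemory]

theorem inputMemory_num_zero : inputMemory a ε 1 0 = ε.num := by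
  simp [inputMemory]

theorem inputMemory_den_zero : inputMemory a ε 2 0 = ε.den := by
  simp [inputMemory]

theorem inputMemory_num_succ (i : Fin n) : inputMemory a ε 1 ((i : ℤ) + 1) = (a i).num := by
  have h : (⟨((i : ℤ) + 1).toNat, by omega⟩ : Fin (n + 1)) = i.succ :=
    Fin.ext (by simp)
  rw [inputMemory, dif_pos (by omega), h, Fin.cons_succ]

theorem inputMemory_den_succ (i : Fin n) : inputMemory a ε 2 ((i : ℤ) + 1) = (a i).den := by
  have h : (⟨((i : ℤ) + 1).toNat, by omega⟩ : Fin (n + 1)) = i.succ :=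
    Fin.ext (by simp)
  rw [inputMemory, dif_pos (by omega), h, Fin.cons_succ]

theorem succ_le_inputSize : n + 1 ≤ inputSize a ε := by
  have h : ∑ i : Fin n, 1 ≤ ∑ i, ratSize (a i) :=
    sum_le_sum fun i _ => by unfold ratSize; omega
  simp only [sum_const, card_univ, Fintype.card_fin, smul_eq_mul, mul_one] at h
  unfold inputSize ratSize at *
  omega

theorem ratSize_le_inputSize (i : Fin n) : ratSize (a i) ≤ inputSize a ε := by
  have := single_le_sum (f := fun i => ratSize (a i)) (fun _ _ => Nat.zero_le _) (mem_univ i)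
  unfold inputSize
  omega

theorem abs_num_lt {r : ℚ} {σ : ℕ} (h : ratSize r ≤ σ) : |r.num| < 2 ^ σ :=
  bitLength_le_iff.1 (by unfold ratSize at h; omega)

theorem den_lt {r : ℚ} {σ : ℕ} (h : ratSize r ≤ σ) : (r.den : ℤ) < 2 ^ σ :=
  (le_abs_self _).trans_lt (bitLength_le_iff.1 (by unfold ratSize at h; omega))

theorem inputMemory_bounded : (inputMemory a ε).Bounded (inputSize a ε) := by
  have hr : ∀ i : Fin (n + 1), ratSize ((Fin.cons ε a : Fin (n + 1) → ℚ) i) ≤ inputSize a ε := by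
    intro i
    refine Fin.cases ?_ (fun i => ?_) i
    · simp [inputSize]
    · simpa using ratSize_le_inputSize i
  intro k j
  match k with
  | 0 =>
    simp only [inputMemory]
    split_ifs
    · rw [abs_of_nonneg (by positivity)]
      have h1 : n < 2 ^ inputSize a ε :=
        (Nat.lt_two_pow_self (n := n)).trans_le
          (Nat.pow_le_pow_right (by norm_num) ((Nat.le_succ n).trans succ_le_inputSize))
      exact_mod_cast h1
    · simp
  | 1 =>
    simp only [inputMemory]
    split_ifs
    · exact abs_num_lt (hr _)
    · simp
  | 2 =>
    simp only [inputMemory]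
    split_ifs
    · rw [abs_of_nonneg (by positivity)]
      exact den_lt (hr _)
    · simp
  | _ + 3 => simp [inputMemory]

end

theorem sum_range_le_sq {x σ : ℕ} (h : x + 1 ≤ σ) : ∑ i ∈ range (x + 1), i ≤ σ ^ 2 := by
  refine (sum_le_card_nsmul _ _ σ fun i hi => ?_).trans ?_
  · have := mem_range.1 hi; omega
  · rw [card_range, smul_eq_mul, sq]
    exact Nat.mul_le_mul_right _ h

section

variable {n σ : ℕ} {u v : ℕ → ℤ} {e f : ℤ}

theorem prod_le_two_pow (hv : ∀ i, 0 < v i) (hv' : ∀ i < n, v i < 2 ^ σ) {x : ℕ} (hx : x ≤ n) :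
    ∏ i ∈ range x, v i ≤ 2 ^ (σ * n) := by
  refine (prod_le_prod (fun i _ => (hv i).le)
    fun i hi => (hv' i ((mem_range.1 hi).trans_le hx)).le).trans ?_
  rw [prod_const, card_range, ← pow_mul]
  exact pow_le_pow_right₀ (by norm_num) (Nat.mul_le_mul_left _ hx)

theorem scale_le (hn : n + 1 ≤ σ) (hf : 0 < f) (hf' : f < 2 ^ σ) {x : ℕ} (hx : x ≤ n + 1) :
    f ^ (2 * x) * 2 ^ (∑ i ∈ range (n + 1), i) ≤ 2 ^ paramLength σ := by
  calc f ^ (2 * x) * 2 ^ (∑ i ∈ range (n + 1), i) ≤ (2 ^ σ) ^ (2 * x) * 2 ^ σ ^ 2 := by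
        gcongr
        · norm_num
        · exact sum_range_le_sq hn
    _ = 2 ^ (σ * (2 * x) + σ ^ 2) := by rw [← pow_mul, ← pow_add]
    _ ≤ 2 ^ paramLength σ := pow_le_pow_right₀ (by norm_num) (by unfold paramLength; nlinarith)

theorem last_le (hn : n + 1 ≤ σ) (he : 0 < e) (he' : e < 2 ^ σ) (hv : ∀ i, 0 < v i)
    (hv' : ∀ i < n, v i < 2 ^ σ) {x : ℕ} (hx : x ≤ n + 1) :
    (∏ i ∈ range n, v i) ^ 2 * e ^ (2 * x) ≤ 2 ^ paramLength σ := by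
  have h1 := prod_le_two_pow hv hv' le_rfl
  have h2 : 0 < ∏ i ∈ range n, v i := prod_pos fun i _ => hv i
  calc (∏ i ∈ range n, v i) ^ 2 * e ^ (2 * x) ≤ (2 ^ (σ * n)) ^ 2 * (2 ^ σ) ^ (2 * x) := by
        gcongr
    _ = 2 ^ (σ * n * 2 + σ * (2 * x)) := by rw [← pow_mul, ← pow_mul, ← pow_add]
    _ ≤ 2 ^ paramLength σ := pow_le_pow_right₀ (by norm_num) (by unfold paramLength; nlinarith)

theorem paramBound (hn : n + 1 ≤ σ) (hu : ∀ i < n, |u i| < 2 ^ σ) (hv : ∀ i, 0 < v i)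
    (hv' : ∀ i < n, v i < 2 ^ σ) (he : 0 < e) (he' : e < 2 ^ σ) (hf : 0 < f) (hf' : f < 2 ^ σ) :
    ParamBound n (paramLength σ) (f ^ (2 * (n + 1)) * 2 ^ (∑ i ∈ range (n + 1), i))
      (∏ i ∈ range n, v i) ((∏ i ∈ range n, v i) ^ 2 * e ^ (2 * (n + 1)))
      (fun i => (∏ i ∈ range n, v i) / v i * u i) := by
  have hV : 0 < ∏ i ∈ range n, v i := prod_pos fun i _ => hv i
  have hV' := prod_le_two_pow hv hv' le_rfl
  refine ⟨by unfold paramLength; omega, by positivity, hV, by positivity, scale_le hn hf hf' le_rfl,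
    hV'.trans (pow_le_pow_right₀ (by norm_num) (by unfold paramLength; nlinarith)),
    last_le hn he he' hv hv' le_rfl, fun i hi => ?_⟩
  have h1 : |(∏ i ∈ range n, v i) / v i| ≤ 2 ^ (σ * n) := by
    refine (Int.abs_ediv_le_abs _ _).trans ?_
    rwa [abs_of_pos hV]
  calc |(∏ i ∈ range n, v i) / v i * u i| ≤ 2 ^ (σ * n) * 2 ^ σ := by
        rw [abs_mul]
        exact mul_le_mul h1 (hu i hi).le (abs_nonneg _) (by positivity)
    _ = 2 ^ (σ * n + σ) := (pow_add _ _ _).symm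
    _ < 2 ^ paramLength σ := pow_lt_pow_right₀ (by norm_num) (by unfold paramLength; nlinarith)

variable {κ V E : ℤ} {b : ℕ → ℤ}

theorem good_init (h : ParamBound n (paramLength σ) κ V E b) :
    Good (n + 1) (approxForm n κ V E b) (2 ^ (3 * paramLength σ * (n + 1))) (initDet n κ V E)
      (initMatrix n κ V E b) :=
  ⟨inv_init h.κ_pos h.V_pos h.E_pos, fun j _ => h.initDet_le j, fun _ hk => h.normSq_init_le hk⟩

theorem paramLength_lt_wordLength (hn : n + 1 ≤ σ) :
    5 * paramLength σ * (n + 1) < wordLength σ := by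
  unfold wordLength
  have h1 := Nat.mul_le_mul_left (5 * paramLength σ) hn
  have h2 := Nat.le_mul_of_pos_right (5 * paramLength σ * σ + 1) (Nat.succ_pos σ)
  simp only [Nat.succ_eq_add_one] at h2
  omega

theorem wordBound (hn : n + 1 ≤ σ) (h : ParamBound n (paramLength σ) κ V E b) :
    WordBound (wordLength σ) (n + 1) (approxForm n κ V E b) (2 ^ (3 * paramLength σ * (n + 1)))
      (2 ^ (5 * paramLength σ * (n + 1))) := by
  have hτ := h.one_le
  refine ⟨?_, by positivity, fun D A hG k hk c hc =>
    h.abs_le hG.inv hG.det_le hk (hG.norm_le k hk) hc, ?_⟩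
  · have h1 : 2 * (n + 1) < 2 ^ (2 * (n + 1)) := Nat.lt_two_pow_self
    have h2 : 2 ^ (2 * (n + 1)) ≤ 2 ^ wordLength σ := Nat.pow_le_pow_right (by norm_num)
      ((paramLength_lt_wordLength hn).le.trans' (Nat.mul_le_mul_right _ (by omega)))
    exact_mod_cast h1.trans_le h2
  · have h1 : (1 : ℤ) ≤ 2 ^ (5 * paramLength σ * (n + 1)) := one_le_pow₀ (by norm_num)
    calc ((2 : ℤ) ^ (5 * paramLength σ * (n + 1)) + 1) ^ (n + 1 + 1)
        ≤ (2 ^ (5 * paramLength σ * (n + 1) + 1)) ^ (n + 1 + 1) := by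
          refine pow_le_pow_left₀ (by positivity) ?_ _
          rw [pow_succ]; omega
      _ = 2 ^ ((5 * paramLength σ * (n + 1) + 1) * (n + 1 + 1)) := (pow_mul _ _ _).symm
      _ < 2 ^ wordLength σ := by
          refine pow_lt_pow_right₀ (by norm_num) ?_
          unfold wordLength
          refine Nat.lt_succ_of_le (Nat.mul_le_mul ?_ (by omega))
          exact Nat.succ_le_succ (Nat.mul_le_mul_left _ hn)

theorem potential_init_lt (hn : n + 1 ≤ σ) (h : ParamBound n (paramLength σ) κ V E b) :
    3 ^ swapBound σ * potential (n + 1) (initDet n κ V E) < 4 ^ swapBound σ := by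
  have h1 : potential (n + 1) (initDet n κ V E) ≤ 2 ^ (3 * paramLength σ * σ ^ 2) := by
    have h2 : ∀ j ∈ range (n + 1), initDet n κ V E j ≤ 2 ^ (3 * paramLength σ * (n + 1)) :=
      fun j _ => h.initDet_le j
    have h3 : ∀ j ∈ range (n + 1), 0 ≤ initDet n κ V E j := fun j hj => by
      have := (good_init h).inv.tri.pos j (mem_range.1 hj).le
      exact_mod_cast this.le
    refine (prod_le_prod h3 h2).trans ?_
    rw [prod_const, card_range, ← pow_mul]
    refine pow_le_pow_right₀ (by norm_num) ?_
    rw [mul_assoc]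
    exact Nat.mul_le_mul_left _ (by nlinarith)
  have h4 : (27 : ℤ) ^ (3 * paramLength σ * σ ^ 2) * 2 ^ (3 * paramLength σ * σ ^ 2) ≤
      64 ^ (3 * paramLength σ * σ ^ 2) := by
    rw [← mul_pow]
    exact pow_le_pow_left₀ (by norm_num) (by norm_num) _
  unfold swapBound
  generalize 3 * paramLength σ * σ ^ 2 = p at *
  have h5 : (0 : ℤ) < 64 ^ p := by positivity
  have h6 := mul_le_mul_of_nonneg_left h1 (by positivity : (0 : ℤ) ≤ 27 ^ p)
  rw [pow_succ, pow_succ, pow_mul, pow_mul]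
  norm_num
  nlinarith

end

set_option maxHeartbeats 1000000 in
/-- The run of the algorithm. -/
theorem wp_approxProg {n : ℕ} (a : Fin n → ℚ) {ε : ℚ} (hε : 0 < ε) {u v : ℕ → ℤ}
    (hu : ∀ i : Fin n, u i = (a i).num) (hv : ∀ i : Fin n, v i = (a i).den) (hv0 : ∀ i, 0 < v i)
    {Q : Memory → Prop}
    (hQ : ∀ M' D A, ∀ s : ℤ,
      Inv (n + 1) (approxForm n ((ε.den : ℤ) ^ (2 * (n + 1)) * 2 ^ (∑ i ∈ range (n + 1), i))
        (∏ i ∈ range n, v i) ((∏ i ∈ range n, v i) ^ 2 * ε.num ^ (2 * (n + 1)))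
        (fun i => (∏ i ∈ range n, v i) / v i * u i)) D A →
      D (n + 1) = ((ε.den : ℤ) ^ (2 * (n + 1)) * 2 ^ (∑ i ∈ range (n + 1), i) *
        (∏ i ∈ range n, v i) ^ 2) ^ n *
        ((∏ i ∈ range n, v i) ^ 2 * ε.num ^ (2 * (n + 1))) →
      (∀ i < n, D (i + 1) * D (i + 1) ≤ 2 * D (i + 2) * D i) →
      (s = 1 ∧ 0 < A 0 (n + 1 + n) ∨ s = -1 ∧ A 0 (n + 1 + n) ≤ 0) →
      M' 3 0 = s * A 0 (n + 1 + n) →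
      (∀ i < n, M' 3 ((i : ℤ) + 1) = s * A 0 (n + 1 + i)) → Q M') :
    WP (costBound (inputSize a ε)) approxProg Q (inputMemory a ε) := by
  set σ := inputSize a ε with hσ
  have hn : n + 1 ≤ σ := succ_le_inputSize
  set e := ε.num with he
  set f : ℤ := (ε.den : ℤ) with hf
  have hεσ : ratSize ε ≤ σ := by simp [hσ, inputSize]
  have he0 : 0 < e := Rat.num_pos.2 hε
  have hf0 : 0 < f := by rw [hf]; exact_mod_cast ε.den_pos
  have he' : e < 2 ^ σ := (le_abs_self _).trans_lt (abs_num_lt hεσ)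
  have hf' : f < 2 ^ σ := den_lt hεσ
  have hu' : ∀ i < n, |u i| < 2 ^ σ := fun i hi => by
    rw [hu ⟨i, hi⟩]; exact abs_num_lt (ratSize_le_inputSize _)
  have hv' : ∀ i < n, v i < 2 ^ σ := fun i hi => by
    rw [hv ⟨i, hi⟩]; exact den_lt (ratSize_le_inputSize _)
  have hP := paramBound hn hu' hv0 hv' he0 he' hf0 hf'
  have hW := wordBound hn hP
  have hG := good_init hP
  have hpot := potential_init_lt hn hP
  set V := ∏ i ∈ range n, v i with hV
  set S := ∑ i ∈ range (n + 1), i with hS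
  set κ := f ^ (2 * (n + 1)) * 2 ^ S with hκ
  set E := V ^ 2 * e ^ (2 * (n + 1)) with hE
  have hV0 : 0 < V := hP.V_pos
  have hτb : 5 * paramLength σ * (n + 1) < wordLength σ := paramLength_lt_wordLength hn
  have hle : ∀ {x : ℤ}, x ≤ 2 ^ (5 * paramLength σ * (n + 1)) → x < 2 ^ wordLength σ :=
    fun h => h.trans_lt (pow_lt_pow_right₀ (by norm_num) hτb)
  have hle1 : ∀ {x : ℤ}, x ≤ 2 ^ paramLength σ → x < 2 ^ wordLength σ := fun h =>
    hle (h.trans (pow_le_pow_right₀ (by norm_num) (by nlinarith)))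
  have hσb : σ ≤ paramLength σ := by unfold paramLength; nlinarith
  have hb0 : (1 : ℤ) < 2 ^ wordLength σ := hle1 (one_le_pow₀ (by norm_num))
  have hσC : (n + 2) * (wordLength σ + 1) ≤ costBound σ := by
    have h1 : n + 2 ≤ (2 * σ + 1) ^ 3 :=
      (by omega : n + 2 ≤ 2 * σ + 1).trans (Nat.le_self_pow (by norm_num) _)
    unfold costBound
    calc (n + 2) * (wordLength σ + 1) ≤ (2 * σ + 1) ^ 3 * (wordLength σ + 1) :=
          Nat.mul_le_mul_right _ h1
      _ ≤ _ := Nat.le_mul_of_pos_left _ (Nat.succ_pos _)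
  have hC1 : (n + 1) * (wordLength σ + 1) ≤ costBound σ :=
    (Nat.mul_le_mul_right _ (by omega)).trans hσC
  have hC : wordLength σ + 1 ≤ costBound σ := by nlinarith
  have hM : (inputMemory a ε).Bounded (wordLength σ) := fun k j =>
    hle1 ((inputMemory_bounded k j).le.trans (pow_le_pow_right₀ (by norm_num) hσb))
  have hnb : (n : ℤ) < 2 ^ wordLength σ := by
    have := hM 0 0
    rwa [inputMemory_zero, abs_of_nonneg (by positivity)] at this
  refine WP.seq (WP.assign hM hC ?_)
  have e1 : (Expr.op .add (var 0) (.const 1)).eval (inputMemory a ε) = (n + 1 : ℕ) := by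
    simp [inputMemory_zero]
  rw [e1]
  have hM1 := hM.write 6 0 (hW.index_lt (i := n + 1) (by omega))
  refine WP.seq (WP.assign hM1 hC ?_)
  have e2 : (Expr.op .mul (.const 2) (var 6)).eval
      ((inputMemory a ε).write 6 0 (n + 1 : ℕ)) = (2 * (n + 1) : ℕ) := by
    simp [Memory.write_same]
  rw [e2]
  have hM2 := hM1.write 5 0 (hW.index_lt (i := 2 * (n + 1)) le_rfl)
  have hag2 : AgreeOff [5, 6] (inputMemory a ε)
      (((inputMemory a ε).write 6 0 (n + 1 : ℕ)).write 5 0 (2 * (n + 1) : ℕ)) :=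
    ((AgreeOff.refl _ _).write (by decide) _ _).write (by decide) _ _
  have h62 : (((inputMemory a ε).write 6 0 (n + 1 : ℕ)).write 5 0 (2 * (n + 1) : ℕ)) 6 0 =
      (n + 1 : ℕ) := by simp [Memory.write_array_ne, Memory.write_same]
  have h52 : (((inputMemory a ε).write 6 0 (n + 1 : ℕ)).write 5 0 (2 * (n + 1) : ℕ)) 5 0 =
      (2 * (n + 1) : ℕ) := Memory.write_same _ _ _ _
  set M2 := ((inputMemory a ε).write 6 0 (n + 1 : ℕ)).write 5 0 (2 * (n + 1) : ℕ)
  have h02 : M2 0 0 = n := by rw [hag2 0 (by decide), inputMemory_zero]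
  have hprodb : ∀ x ≤ n, |∏ i ∈ range x, v i| < 2 ^ wordLength σ := fun x hx => by
    rw [abs_of_pos (prod_pos fun i _ => hv0 i)]
    refine hle1 ((prod_le_two_pow hv0 hv' hx).trans (pow_le_pow_right₀ (by norm_num) ?_))
    unfold paramLength; nlinarith
  refine WP.seq (wp_products (v := v) hM2 le_rfl h02 (fun i hi => ?_) hnb hprodb (fun x hx => ?_)
    (fun x hx => ?_) hC1 ?_)
  · rw [hag2 2 (by decide), hv ⟨i, hi⟩]
    exact inputMemory_den_succ ⟨i, hi⟩
  · exact hle1 (pow_le_pow_right₀ (by norm_num) (by omega))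
  · refine hle1 (pow_le_pow_right₀ (by norm_num) ((sum_range_le_sq (σ := σ) (by omega)).trans ?_))
    unfold paramLength; omega
  intro M3 hM3 hag3 h21 h23
  have hag3' : AgreeOff [5, 6, 8, 21, 22, 23] (inputMemory a ε) M3 := fun k hk => by
    rw [hag3 k (by simp at hk ⊢; tauto), hag2 k (by simp at hk ⊢; tauto)]
  refine WP.seq (wp_weights (m := n + 1) (V := V) (e := e) (f := f) (p := 2 ^ S) hM3 le_rfl
    ?_ ?_ ?_ h21 h23 ?_ (fun x hx => ?_) (fun x hx => ?_) hσC ?_)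
  · rw [hag3 6 (by decide), h62]
  · rw [hag3' 1 (by decide), inputMemory_num_zero]
  · rw [hag3' 2 (by decide), inputMemory_den_zero]
  · have := hW.index_lt (i := n + 1) (by omega)
    rwa [abs_of_nonneg (by positivity)] at this
  · rw [abs_of_pos (by positivity)]
    exact hle1 (scale_le hn hf0 hf' hx)
  · rw [abs_of_pos (by positivity)]
    exact hle1 (last_le hn he0 he' hv0 hv' hx)
  intro M4 hM4 hag4 h23' h24'
  have hag4' : AgreeOff [5, 6, 8, 21, 22, 23, 24] (inputMemory a ε) M4 := fun k hk => by
    rw [hag4 k (by simp at hk ⊢; tauto), hag3' k (by simp at hk ⊢; tauto)]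
  have h04 : M4 0 0 = n := by rw [hag4' 0 (by decide), inputMemory_zero]
  have h54 : M4 5 0 = (2 * (n + 1) : ℕ) := by rw [hag4 5 (by decide), hag3 5 (by decide), h52]
  have h64 : M4 6 0 = (n + 1 : ℕ) := by rw [hag4 6 (by decide), hag3 6 (by decide), h62]
  refine WP.seq (wp_fill (κ := κ) (V := V) (E := E) (u := u) (v := v) hM4 le_rfl h04 ?_ h54 h64
    (fun i hi => ?_) (fun i hi => ?_) ?_ h23' h24' hb0 hnb (fun x hx => ?_)
    (fun i hi c hc => hW.lt_of_le (hW.entry_le _ _ hG i hi c hc)) hC1 ?_)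
  · rw [hag4' 4 (by decide)]; rfl
  · rw [hag4' 1 (by decide), hu ⟨i, hi⟩]
    exact inputMemory_num_succ ⟨i, hi⟩
  · rw [hag4' 2 (by decide), hv ⟨i, hi⟩]
    exact inputMemory_den_succ ⟨i, hi⟩
  · rw [hag4 21 (by decide), h21]
  · rw [abs_of_pos (by have := hP.κ_pos; positivity)]
    refine hle ((hP.K_pow_le (a := n + 1) (by omega)).trans
      (pow_le_pow_right₀ (by norm_num) (Nat.mul_le_mul_right _ (Nat.mul_le_mul_right _ ?_))))
    norm_num
  intro M5 hM5 hag5 hA5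
  refine WP.seq (wp_reduce (n := n) (m := n + 1) rfl hM5 le_rfl hW ?_ ?_ ?_ hA5 hG hpot ?_ ?_)
  · rw [hag5 0 (by decide), h04]
  · rw [hag5 5 (by decide), h54]
  · rw [hag5 6 (by decide), h64]
  · unfold costBound
    gcongr
  intro M6 D A hM6 h06 h56 h66 hA6 hG6 hD hall
  refine wp_output hM6 le_rfl h06 h56 h66 hA6 hb0 hnb hC1 ?_
  intro M7 s hs h3 h3'
  refine hQ M7 D A s hG6.inv ?_ hall hs h3 h3'
  rw [hD]
  simp [initDet]

theorem abs_sub_le_of_sq {V b x q u v e f : ℤ} (hV : 0 < V) (hv : 0 < v) (hf : 0 < f) (he : 0 < e)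
    (hb : b * v = V * u) (h : (V * x - b * q) ^ 2 * f ^ 2 ≤ V ^ 2 * e ^ 2) :
    |(x : ℚ) - q * (u / v)| ≤ e / f := by
  have hV' : (0 : ℚ) < V := by exact_mod_cast hV
  have hv' : (0 : ℚ) < v := by exact_mod_cast hv
  have hf' : (0 : ℚ) < f := by exact_mod_cast hf
  have he' : (0 : ℚ) < e := by exact_mod_cast he
  have h1 : |(V * x - b * q) * f| ≤ V * e :=
    abs_le_of_sq_le_sq (by rw [mul_pow, mul_pow]; exact h) (by positivity)
  have hb' : (b : ℚ) = V * (u / v) := by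
    rw [← mul_div_assoc, eq_div_iff hv'.ne']; exact_mod_cast hb
  have h2 : |((V : ℚ) * x - b * q) * f| ≤ V * e := by exact_mod_cast h1
  have h3 : ((V : ℚ) * x - b * q) * f = V * ((x - q * (u / v)) * f) := by rw [hb']; ring
  rw [h3, abs_mul, abs_of_pos hV', abs_mul, abs_of_pos hf'] at h2
  rw [le_div_iff₀ hf']
  exact le_of_mul_le_mul_left h2 hV'

theorem le_rpow_of_sq_le {n : ℕ} {q e f : ℤ} (he : 0 < e) (hf : 0 < f)
    (h : q ^ 2 * e ^ (2 * n) ≤ 2 ^ (∑ i ∈ range (n + 1), i) * f ^ (2 * n)) :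
    (q : ℝ) ≤ (2 : ℝ) ^ ((n : ℝ) * ((n : ℝ) + 1) / 4) * ((e : ℝ) / f) ^ (-(n : ℤ)) := by
  have he' : (0 : ℝ) < e := by exact_mod_cast he
  have hf' : (0 : ℝ) < f := by exact_mod_cast hf
  refine le_of_sq_le_sq ?_ (by positivity)
  have hS : ((∑ i ∈ range (n + 1), i : ℕ) : ℝ) = n * (n + 1) / 2 := by
    have := Finset.sum_range_id_mul_two (n + 1)
    rw [eq_div_iff (by norm_num)]
    have h2 : (∑ i ∈ range (n + 1), i) * 2 = n * (n + 1) := by rw [this, mul_comm]; rfl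
    exact_mod_cast h2
  have h1 : ((2 : ℝ) ^ ((n : ℝ) * ((n : ℝ) + 1) / 4)) ^ 2 = 2 ^ (∑ i ∈ range (n + 1), i) := by
    rw [← Real.rpow_natCast, ← Real.rpow_natCast, ← Real.rpow_mul (by norm_num), hS]
    congr 1
    push_cast
    ring
  have h2 : (((e : ℝ) / f) ^ (-(n : ℤ))) ^ 2 = f ^ (2 * n) / e ^ (2 * n) := by
    rw [zpow_neg, zpow_natCast, ← inv_pow, inv_div, ← pow_mul, mul_comm n 2, div_pow]
  rw [mul_pow, h1, h2, ← mul_div_assoc, le_div_iff₀ (by positivity)]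
  exact_mod_cast h

end SimultaneousApproximation

open SimultaneousApproximation LatticeReduction in
theorem proposition4p1 :
    ∃ (P : RAM.Program) (T : Polynomial ℕ), ∀ (n : ℕ) (a : Fin n → ℚ) (ε : ℚ), 0 < ε → ε < 1 →
      ∃ (t : ℕ) (M : RAM.Memory) (p : Fin n → ℤ) (q : ℤ),
        RAM.Runs P (SimultaneousApproximation.inputMemory a ε) t M ∧
        t ≤ T.eval (SimultaneousApproximation.inputSize a ε) ∧
        SimultaneousApproximation.HoldsOutput M p q ∧
        (∀ i : Fin n, |(p i : ℚ) - (q : ℚ) * a i| ≤ ε) ∧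
        1 ≤ q ∧ (q : ℝ) ≤ (2 : ℝ) ^ ((n : ℝ) * ((n : ℝ) + 1) / 4) * (ε : ℝ) ^ (-(n : ℤ)) := by
  let τ : Polynomial ℕ := 4 * .X ^ 2 + 1
  let w : Polynomial ℕ := (5 * τ * .X + 1) * (.X + 1) + 1
  let s : Polynomial ℕ := 3 * (3 * τ * .X ^ 2) + 1
  refine ⟨approxProg, .C approxProg.weight * ((s + 1) * ((2 * .X + 1) ^ 3 * (w + 1))),
    fun n a ε hε hε1 => ?_⟩
  let u : ℕ → ℤ := fun i => if h : i < n then (a ⟨i, h⟩).num else 0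
  let v : ℕ → ℤ := fun i => if h : i < n then (a ⟨i, h⟩).den else 1
  have hu : ∀ i : Fin n, u i = (a i).num := fun i => by simp [u]
  have hv : ∀ i : Fin n, v i = (a i).den := fun i => by simp [v]
  have hv0 : ∀ i, 0 < v i := fun i => by
    simp only [v]
    split_ifs with h
    · exact_mod_cast (a ⟨i, h⟩).den_pos
    · norm_num
  have main : RAM.WP (costBound (inputSize a ε)) approxProg
      (fun M => ∃ (p : Fin n → ℤ) (q : ℤ), HoldsOutput M p q ∧
        (∀ i : Fin n, |(p i : ℚ) - (q : ℚ) * a i| ≤ ε) ∧ 1 ≤ q ∧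
        (q : ℝ) ≤ (2 : ℝ) ^ ((n : ℝ) * ((n : ℝ) + 1) / 4) * (ε : ℝ) ^ (-(n : ℤ)))
      (inputMemory a ε) := by
    refine wp_approxProg a hε hu hv hv0 ?_
    intro M D A s hI hD hall hs h3 h3'
    have he : 0 < ε.num := Rat.num_pos.2 hε
    have hf : (0 : ℤ) < ε.den := by exact_mod_cast ε.den_pos
    have hV : 0 < ∏ i ∈ Finset.range n, v i := Finset.prod_pos fun i _ => hv0 i
    obtain ⟨h4, h5, i0, hi0, hne⟩ := approx_of_reduced he hf hV rfl rfl hI hD hall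
    set V := ∏ i ∈ Finset.range n, v i
    set q0 := A 0 (n + 1 + n) with hq0
    have hs2 : s ^ 2 = 1 := by rcases hs with ⟨rfl, -⟩ | ⟨rfl, -⟩ <;> norm_num
    have hef : ε.num < ε.den := Rat.num_lt_denom_iff.2 hε1
    have hq0ne : q0 ≠ 0 := by
      intro hq
      rcases (by omega : i0 < n ∨ i0 = n) with hlt | rfl
      · have h6 := h4 i0 hlt
        rw [hq, mul_zero, sub_zero, mul_pow, mul_assoc] at h6
        have h7 := le_of_mul_le_mul_left h6 (by positivity)
        have h8 : 1 ≤ A 0 (n + 1 + i0) ^ 2 := by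
          have : 0 < A 0 (n + 1 + i0) ^ 2 := by positivity
          omega
        nlinarith
      · exact hne hq
    refine ⟨fun i => s * A 0 (n + 1 + i), s * q0, ⟨h3, fun i => h3' i i.2⟩, fun i => ?_, ?_, ?_⟩
    · have hdvd : V / v i * v i = V :=
        Int.ediv_mul_cancel (Finset.dvd_prod_of_mem v (Finset.mem_range.2 i.2))
      have h6 := abs_sub_le_of_sq (V := V) (b := V / v i * u i) (x := s * A 0 (n + 1 + i))
        (q := s * q0) (u := u i) (v := v i) hV (hv0 i) hf he
        (by rw [mul_right_comm, hdvd]) (by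
          calc (V * (s * A 0 (n + 1 + i)) - V / v i * u i * (s * q0)) ^ 2 * (ε.den : ℤ) ^ 2
              = s ^ 2 * ((V * A 0 (n + 1 + i) - V / v i * u i * q0) ^ 2 * (ε.den : ℤ) ^ 2) := by
                ring
            _ ≤ _ := by rw [hs2, one_mul]; exact h4 i i.2)
      rw [hu, hv] at h6
      push_cast at h6 ⊢
      rwa [Rat.num_div_den, Rat.num_div_den] at h6
    · rcases hs with ⟨rfl, h6⟩ | ⟨rfl, h6⟩ <;> omega
    · have h6 := le_rpow_of_sq_le (n := n) (q := s * q0) he hf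
        (by rw [mul_pow, hs2, one_mul]; exact h5)
      have h7 : (ε : ℝ) = (ε.num : ℝ) / ((ε.den : ℤ) : ℝ) := by
        rw [Int.cast_natCast]; exact Rat.cast_def ε
      rwa [h7]
  obtain ⟨t, M, hrun, ht, p, q, hout⟩ := main
  refine ⟨t, M, p, q, hrun, ht.trans_eq ?_, hout⟩
  simp [costBound, swapBound, wordLength, paramLength, s, w, τ]
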